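/- Let $N,P\ge 1$ be integers and put $\gamma=P/N$. Let $K=\mathrm{diag}(d_1,\dots,d_N)$ be a deterministic diagonal matrix with $d_1,\dots,d_N\ge 0$, and let $W$ be a $P\times N$ random matrix with i.i.d. standard (real) Gaussian entries. Define the Stieltjes transform of the generalized Wishart matrix $\frac1P WKW^{T}$ by $$m_P(z)=\frac1P\,\mathrm{Tr}\Big[\Big(\tfrac1P WKW^{T}-z\,\mathrm I_P\Big)^{-1}\Big].$$ For every $z\in\mathbb C$ with $\mathrm{Re}(z)<0$, the equation $$\gamma=\frac1N\sum_{i=1}^N\frac{d_i\,\tilde m(z)}{1+d_i\,\tilde m(z)}-\gamma z\,\tilde m(z)$$ has a unique solution $\tilde m(z)$ in the cone $\mathcal C_z=\{u-\frac1z v:\ u,v\ge 0\}$ spanned by $1$ and $-\frac1z$; the random variable $m_P(z)$ is integrable, and $$\big|\mathbb E[m_P(z)]-\tilde m(z)\big|\le\frac{\mathbf e}{P},$$ where the constant $\mathbf e$ depends only on $z$, $\gamma$ and $\frac1N\mathrm{Tr}(K)$. -/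

import Mathlib

open MeasureTheory ProbabilityTheory

/-- The generalized Wishart matrix `(1/P) W K Wᵀ`, of size `P × P`. -/
noncomputable def generalizedWishart {P N : ℕ} (K : Matrix (Fin N) (Fin N) ℝ)
    (W : Matrix (Fin P) (Fin N) ℝ) : Matrix (Fin P) (Fin P) ℝ :=
  (1 / (P : ℝ)) • (W * K * W.transpose)

/-- The Stieltjes transform `m_P(z) = (1/P) Tr[((1/P) W K Wᵀ - z I_P)⁻¹]`. -/
noncomputable def stieltjesTransform {P N : ℕ} (K : Matrix (Fin N) (Fin N) ℝ)
    (W : Matrix (Fin P) (Fin N) ℝ) (z : ℂ) : ℂ :=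
  (1 / (P : ℂ)) *
    ((generalizedWishart K W).map Complex.ofReal - z • (1 : Matrix (Fin P) (Fin P) ℂ))⁻¹.trace

/-- The convex cone `C_z = {u - v / z : u, v ≥ 0}` spanned by `1` and `-1/z`. -/
def spannedCone (z : ℂ) : Set ℂ :=
  {t | ∃ u v : ℝ, 0 ≤ u ∧ 0 ≤ v ∧ t = (u : ℂ) - 1 / z * (v : ℂ)}

/-- `m` lies in the cone `C_z` and solves
`γ = (1/N) ∑ i, d i * m / (1 + d i * m) - γ z m`. -/
def IsConeSolution {N : ℕ} (d : Fin N → ℝ) (γ : ℝ) (z m : ℂ) : Prop :=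
  m ∈ spannedCone z ∧
    (γ : ℂ) = 1 / (N : ℂ) * ∑ i, (d i : ℂ) * m / (1 + (d i : ℂ) * m) - (γ : ℂ) * z * m

/-- The entries of the random matrix `W` are independent standard Gaussian variables. -/
def IsStdGaussianMatrix {Ω : Type*} [MeasurableSpace Ω] {P N : ℕ}
    (W : Ω → Matrix (Fin P) (Fin N) ℝ) (μ : Measure Ω) : Prop :=
  (∀ p i, HasLaw (fun ω => W ω p i) (gaussianReal 0 1) μ) ∧
    iIndepFun (fun (q : Fin P × Fin N) ω => W ω q.1 q.2) μ

/-! Write `s` for the Stieltjes transform, `g i` for the normalized quadratic form of the resolvent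
with column `i` removed, taken at that column, and `t i` for the normalized trace of that resolvent.
Sherman-Morrison gives the exact identity `P + z P s = ∑ d i * g i / (1 + d i * g i)`
(`stieltjesTransform_cavity_eq`), and the cone solution `m` satisfies the same equation with `m` in
place of both `s` and `g i`. So everything reduces to stability of this equation and to the size of
`g i - s`.

Stability comes from the cone. All of `s`, `g i`, `m` lie in it, and for two cone elements the
divided difference of the equation has modulus at least `P ‖z‖` (`norm_divided_difference_ge`). This
yields uniqueness at once. Existence follows since the equation is a fixed-point problem for a map
that strictly contracts hyperbolic distance on the right half-plane and sends the cone into a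
compact part of itself (`exists_fixedPoint`).

For the estimate, `t i - s` is `O(1/P)` by a rank-one trace bound, and `g i - t i` is a centred
quadratic form in Gaussians independent of its coefficients: it has mean zero and variance `O(1/P)`.
First-order stability then bounds the mean square of `g i - m` by `O(1/P)`, which alone would only
give a rate `1/√P` for `s - m`. Expanding to second order around `m` (`norm_linearized_le`), the
linear term in `g i - t i` vanishes in expectation, leaving remainders of size `O(1/P)`. Only `∑ d
i` enters the constants, because `d/(1 + d m)` is bounded by `1/‖m‖` and `1/‖m‖` by `‖z‖ + (∑ d
i)/P`. -/

/-! ### Geometry of the cone, stability and uniqueness -/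

section Cone

variable {z : ℂ}

lemma normSq_pos_of_re_neg (hz : z.re < 0) : 0 < Complex.normSq z :=
  Complex.normSq_pos.2 fun h => by simp [h] at hz

lemma norm_pos_of_re_neg (hz : z.re < 0) : 0 < ‖z‖ :=
  norm_pos_iff.2 fun h => by simp [h] at hz

lemma neg_inv_eq_conj (z : ℂ) (v : ℝ) :
    -(1 / z * (v : ℂ)) = -(starRingEnd ℂ z) * ((v / Complex.normSq z : ℝ) : ℂ) := by
  rw [one_div, Complex.inv_def]
  push_cast
  ring

/-- The cone spanned by `1` and `-1/z` is also spanned by `1` and `-conj z`. -/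
lemma mem_spannedCone_iff (hz : z.re < 0) {t : ℂ} :
    t ∈ spannedCone z ↔
      ∃ u v : ℝ, 0 ≤ u ∧ 0 ≤ v ∧ t = (u : ℂ) - starRingEnd ℂ z * (v : ℂ) := by
  have h0 := normSq_pos_of_re_neg hz
  constructor
  · rintro ⟨u, v, hu, hv, rfl⟩
    refine ⟨u, v / Complex.normSq z, hu, by positivity, ?_⟩
    rw [sub_eq_add_neg, neg_inv_eq_conj]
    ring
  · rintro ⟨u, v, hu, hv, rfl⟩
    refine ⟨u, v * Complex.normSq z, hu, by positivity, ?_⟩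
    rw [sub_eq_add_neg (u : ℂ) (1 / z * _), neg_inv_eq_conj, mul_div_cancel_right₀ _ h0.ne']
    ring

lemma spannedCone_add {s t : ℂ} (hs : s ∈ spannedCone z) (ht : t ∈ spannedCone z) :
    s + t ∈ spannedCone z := by
  obtain ⟨u, v, hu, hv, rfl⟩ := hs
  obtain ⟨u', v', hu', hv', rfl⟩ := ht
  exact ⟨u + u', v + v', by positivity, by positivity, by push_cast; ring⟩

lemma spannedCone_smul {c : ℝ} (hc : 0 ≤ c) {t : ℂ} (ht : t ∈ spannedCone z) :
    (c : ℂ) * t ∈ spannedCone z := by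
  obtain ⟨u, v, hu, hv, rfl⟩ := ht
  exact ⟨c * u, c * v, by positivity, by positivity, by push_cast; ring⟩

lemma ofReal_mem_spannedCone {c : ℝ} (hc : 0 ≤ c) : (c : ℂ) ∈ spannedCone z :=
  ⟨c, 0, hc, le_rfl, by simp⟩

lemma spannedCone_sum {ι : Type*} (s : Finset ι) {f : ι → ℂ}
    (h : ∀ i ∈ s, f i ∈ spannedCone z) : ∑ i ∈ s, f i ∈ spannedCone z := by
  classical
  induction s using Finset.induction_on with
  | empty => simpa using ofReal_mem_spannedCone (z := z) le_rfl
  | insert a s ha ih =>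
    rw [Finset.sum_insert ha]
    exact spannedCone_add (h a (by simp)) (ih fun i hi => h i (by simp [hi]))

lemma re_nonneg_of_mem_spannedCone (hz : z.re < 0) {t : ℂ} (ht : t ∈ spannedCone z) :
    0 ≤ t.re := by
  obtain ⟨u, v, hu, hv, rfl⟩ := (mem_spannedCone_iff hz).1 ht
  simp
  nlinarith

lemma one_add_mem_spannedCone {d : ℝ} (hd : 0 ≤ d) {t : ℂ} (ht : t ∈ spannedCone z) :
    1 + (d : ℂ) * t ∈ spannedCone z := by
  simpa using spannedCone_add (ofReal_mem_spannedCone zero_le_one) (spannedCone_smul hd ht)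

/-- The conjugate of `1/s` is `s` divided by `|s|²`, a nonnegative real multiple of `s`. -/
lemma conj_inv_mem_spannedCone {s : ℂ} (hs : s ∈ spannedCone z) :
    starRingEnd ℂ s⁻¹ ∈ spannedCone z := by
  rw [Complex.inv_def, map_mul, Complex.conj_conj, Complex.conj_ofReal, mul_comm]
  exact spannedCone_smul (inv_nonneg.2 (Complex.normSq_nonneg s)) hs

lemma inv_mem_spannedCone {s : ℂ} (hs : starRingEnd ℂ s ∈ spannedCone z) :
    s⁻¹ ∈ spannedCone z := by
  simpa using conj_inv_mem_spannedCone hs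

/-- With `θ = arg (-conj z)`, nonzero cone elements have arguments between `0` and `θ`, and `-z` has
argument `-θ`. The product thus has argument between `-θ` and `θ`, where `|θ| < π/2`. The proof
checks this on the generators `1` and `-conj z`. -/
lemma re_neg_mul_mul_nonneg (hz : z.re < 0) {s t : ℂ} (hs : s ∈ spannedCone z)
    (ht : t ∈ spannedCone z) : 0 ≤ (-z * (s * t)).re := by
  obtain ⟨u, v, hu, hv, rfl⟩ := (mem_spannedCone_iff hz).1 hs
  obtain ⟨u', v', hu', hv', rfl⟩ := (mem_spannedCone_iff hz).1 ht
  have : (-z * (((u : ℂ) - starRingEnd ℂ z * v) * ((u' : ℂ) - starRingEnd ℂ z * v'))).re =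
      -z.re * (u * u') + Complex.normSq z * (u * v' + v * u')
        + -z.re * Complex.normSq z * (v * v') := by
    simp [Complex.normSq_apply]
    ring
  rw [this]
  have := Complex.normSq_nonneg z
  have hz' : 0 ≤ -z.re := by linarith
  positivity

/-- Conjugate form of the preceding inequality, applied to the conjugated inverses, which stay in
the cone. -/
lemma re_neg_conj_div_nonneg (hz : z.re < 0) {s t : ℂ} (hs : s ∈ spannedCone z)
    (ht : t ∈ spannedCone z) : 0 ≤ (-(starRingEnd ℂ z) / (s * t)).re := by
  have h := re_neg_mul_mul_nonneg hz (conj_inv_mem_spannedCone hs) (conj_inv_mem_spannedCone ht)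
  rw [← Complex.conj_re] at h
  convert h using 2
  simp only [map_mul, map_neg, Complex.conj_conj, div_eq_mul_inv, mul_inv]

variable {ι : Type*} [Fintype ι] {d : ι → ℝ}

/-- The divided difference of the fixed-point equation is bounded away from zero on the cone. -/
lemma norm_divided_difference_ge (hz : z.re < 0) (hd : ∀ i, 0 ≤ d i) (p : ℕ) {s t : ℂ}
    (hs : s ∈ spannedCone z) (ht : t ∈ spannedCone z) :
    (p : ℝ) * ‖z‖ ≤
      ‖z * p - ∑ i, (d i : ℂ) / ((1 + (d i : ℂ) * s) * (1 + (d i : ℂ) * t))‖ := by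
  have hz0 := norm_pos_of_re_neg hz
  set X := z * p - ∑ i, (d i : ℂ) / ((1 + (d i : ℂ) * s) * (1 + (d i : ℂ) * t))
  -- Rotating by `conj z` makes the leading term real and positive, and every summand then has
  -- nonnegative real part, so nothing cancels.
  have h1 : (p : ℝ) * ‖z‖ ^ 2 ≤ (starRingEnd ℂ z * X).re := by
    have : starRingEnd ℂ z * X = (((p : ℝ) * ‖z‖ ^ 2 : ℝ) : ℂ) + ∑ i, (d i : ℂ) *
        (-(starRingEnd ℂ z) / ((1 + (d i : ℂ) * s) * (1 + (d i : ℂ) * t))) := by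
      rw [mul_sub, sub_eq_add_neg, Finset.mul_sum, ← Finset.sum_neg_distrib]
      congr 1
      · rw [← Complex.normSq_eq_norm_sq]
        push_cast
        rw [Complex.normSq_eq_conj_mul_self]
        ring
      · exact Finset.sum_congr rfl fun i _ => by ring
    rw [this, Complex.add_re, Complex.ofReal_re, Complex.re_sum]
    refine le_add_of_nonneg_right (Finset.sum_nonneg fun i _ => ?_)
    rw [Complex.re_ofReal_mul]
    exact mul_nonneg (hd i) (re_neg_conj_div_nonneg hz (one_add_mem_spannedCone (hd i) hs)
      (one_add_mem_spannedCone (hd i) ht))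
  have h2 := h1.trans (Complex.re_le_norm _)
  rw [norm_mul, Complex.norm_conj] at h2
  nlinarith

lemma one_le_norm_one_add {d : ℝ} (hd : 0 ≤ d) {t : ℂ} (ht : 0 ≤ t.re) :
    1 ≤ ‖1 + (d : ℂ) * t‖ := by
  refine le_trans ?_ (Complex.re_le_norm _)
  simp
  positivity

lemma one_add_ne_zero {d : ℝ} (hd : 0 ≤ d) {t : ℂ} (ht : 0 ≤ t.re) :
    1 + (d : ℂ) * t ≠ 0 :=
  norm_pos_iff.1 (zero_lt_one.trans_le (one_le_norm_one_add hd ht))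

lemma div_sub_div_one_add {d : ℝ} (hd : 0 ≤ d) {s t : ℂ} (hs : 0 ≤ s.re) (ht : 0 ≤ t.re) :
    (d : ℂ) * s / (1 + d * s) - (d : ℂ) * t / (1 + d * t) =
      (s - t) * ((d : ℂ) / ((1 + d * s) * (1 + d * t))) := by
  have h1 := one_add_ne_zero hd hs
  have h2 := one_add_ne_zero hd ht
  field_simp
  ring

/-- The fixed-point equation, multiplied through by `N`. -/
lemma isConeSolution_iff {N P : ℕ} (hN : 0 < N) (d : Fin N → ℝ) (m : ℂ) :
    IsConeSolution d ((P : ℝ) / N) z m ↔ m ∈ spannedCone z ∧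
      (P : ℂ) + z * P * m = ∑ i, (d i : ℂ) * m / (1 + (d i : ℂ) * m) := by
  have hN' : (N : ℂ) ≠ 0 := by exact_mod_cast hN.ne'
  unfold IsConeSolution
  refine and_congr_right fun _ => ?_
  push_cast
  generalize ∑ i, (d i : ℂ) * m / (1 + (d i : ℂ) * m) = T
  constructor
  · intro h
    field_simp at h
    linear_combination h
  · intro h
    field_simp
    linear_combination h

lemma isConeSolution_unique (hz : z.re < 0) {N P : ℕ} (hN : 0 < N) (hP : 0 < P) {d : Fin N → ℝ}
    (hd : ∀ i, 0 ≤ d i) {s t : ℂ} (hs : IsConeSolution d ((P : ℝ) / N) z s)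
    (ht : IsConeSolution d ((P : ℝ) / N) z t) : s = t := by
  obtain ⟨hs1, hs2⟩ := (isConeSolution_iff hN d s).1 hs
  obtain ⟨ht1, ht2⟩ := (isConeSolution_iff hN d t).1 ht
  have hs0 := re_nonneg_of_mem_spannedCone hz hs1
  have ht0 := re_nonneg_of_mem_spannedCone hz ht1
  have h := norm_divided_difference_ge hz hd P hs1 ht1
  have hP' : (0 : ℝ) < P := by exact_mod_cast hP
  have hX := norm_pos_iff.1 ((mul_pos hP' (norm_pos_of_re_neg hz)).trans_le h)
  refine sub_eq_zero.1 ((mul_eq_zero.1 ?_).resolve_right hX)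
  rw [mul_sub, Finset.mul_sum, ← Finset.sum_congr rfl
    (fun i _ => div_sub_div_one_add (hd i) hs0 ht0), Finset.sum_sub_distrib, ← hs2, ← ht2]
  ring

end Cone

/-! ### Existence of the cone solution by hyperbolic contraction -/

section FixedPoint

variable {ι : Type*} [Fintype ι]

/-- The reciprocal of the fixed-point map whose fixed points solve the cone equation. -/
noncomputable def fixedPointDenom (d : ι → ℝ) (P : ℕ) (z m : ℂ) : ℂ :=
  -z + 1 / (P : ℂ) * ∑ i, (d i : ℂ) / (1 + (d i : ℂ) * m)

/-- The mean square size of the resolvent weights. -/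
noncomputable def weightEnergy (d : ι → ℝ) (P : ℕ) (m : ℂ) : ℝ :=
  1 / (P : ℝ) * ∑ i, (d i / ‖1 + (d i : ℂ) * m‖) ^ 2

variable {d : ι → ℝ} {P : ℕ} {z : ℂ}

lemma weightEnergy_nonneg (m : ℂ) : 0 ≤ weightEnergy d P m := by
  unfold weightEnergy; positivity

lemma norm_fixedPointDenom_le (hd : ∀ i, 0 ≤ d i) {m : ℂ} (hm : 0 ≤ m.re) :
    ‖fixedPointDenom d P z m‖ ≤ ‖z‖ + (∑ i, d i) / P := by
  unfold fixedPointDenom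
  refine (norm_add_le _ _).trans ?_
  rw [norm_neg, norm_mul]
  gcongr
  rw [norm_div, norm_one, Complex.norm_natCast, div_mul_eq_mul_div, one_mul]
  gcongr
  refine (norm_sum_le _ _).trans (Finset.sum_le_sum fun i _ => ?_)
  rw [norm_div, Complex.norm_real, Real.norm_of_nonneg (hd i)]
  exact div_le_self (hd i) (one_le_norm_one_add (hd i) hm)

/-- The real part of `d/(1 + d m)` is `d (1 + d Re m)/|1 + d m|²`; the nonnegative part `d/|1 + d
m|²` is dropped. -/
lemma re_fixedPointDenom_ge (hd : ∀ i, 0 ≤ d i) {m : ℂ} (hm : 0 ≤ m.re) :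
    -z.re + m.re * weightEnergy d P m ≤ (fixedPointDenom d P z m).re := by
  have hc : (1 / (P : ℂ)) = ((1 / (P : ℝ) : ℝ) : ℂ) := by push_cast; rfl
  unfold fixedPointDenom weightEnergy
  rw [hc, Complex.add_re, Complex.neg_re, Complex.re_ofReal_mul, Complex.re_sum, mul_left_comm]
  gcongr
  rw [Finset.mul_sum]
  refine Finset.sum_le_sum fun i _ => ?_
  have h1 := one_le_norm_one_add (hd i) hm
  rw [div_eq_mul_inv (d i : ℂ), Complex.re_ofReal_mul, Complex.inv_re, Complex.normSq_eq_norm_sq]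
  rw [div_pow, mul_div_assoc', mul_div_assoc']
  refine div_le_div_of_nonneg_right ?_ (sq_nonneg _)
  simp
  nlinarith [hd i]

lemma fixedPointDenom_sub (hd : ∀ i, 0 ≤ d i) {a b : ℂ} (ha : 0 ≤ a.re) (hb : 0 ≤ b.re) :
    fixedPointDenom d P z b - fixedPointDenom d P z a =
      (a - b) * (1 / (P : ℂ) * ∑ i, (d i / (1 + (d i : ℂ) * a)) * (d i / (1 + (d i : ℂ) * b))) := by
  unfold fixedPointDenom
  rw [add_sub_add_left_eq_sub, ← mul_sub, mul_left_comm, Finset.mul_sum]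
  congr 1
  rw [← Finset.sum_sub_distrib]
  refine Finset.sum_congr rfl fun i _ => ?_
  have h1 := one_add_ne_zero (hd i) ha
  have h2 := one_add_ne_zero (hd i) hb
  field_simp
  ring

/-- Cauchy-Schwarz decouples `a` and `b`, matching the product of the two lower bounds from
`re_fixedPointDenom_ge`. -/
lemma norm_fixedPointDenom_sub_sq_le (hd : ∀ i, 0 ≤ d i) {a b : ℂ} (ha : 0 ≤ a.re)
    (hb : 0 ≤ b.re) :
    ‖fixedPointDenom d P z b - fixedPointDenom d P z a‖ ^ 2 ≤
      ‖a - b‖ ^ 2 * (weightEnergy d P a * weightEnergy d P b) := by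
  rw [fixedPointDenom_sub hd ha hb, norm_mul, mul_pow]
  gcongr
  have h : ‖1 / (P : ℂ) * ∑ i, ((d i : ℂ) / (1 + (d i : ℂ) * a)) * (d i / (1 + (d i : ℂ) * b))‖ ≤
      1 / (P : ℝ) * ∑ i, (d i / ‖1 + (d i : ℂ) * a‖) * (d i / ‖1 + (d i : ℂ) * b‖) := by
    rw [norm_mul, norm_div, norm_one, Complex.norm_natCast]
    gcongr
    refine (norm_sum_le _ _).trans (Finset.sum_le_sum fun i _ => ?_)
    simp [abs_of_nonneg (hd i)]
  refine (pow_le_pow_left₀ (norm_nonneg _) h 2).trans ?_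
  unfold weightEnergy
  rw [mul_pow, mul_mul_mul_comm, ← sq]
  gcongr
  exact Finset.sum_mul_sq_le_sq_mul_sq _ _ _

/-- The fixed-point map strictly contracts `‖a - b‖² / (Re a · Re b)` on the right half-plane. -/
lemma fixedPoint_strict_contraction (hz : z.re < 0) (hd : ∀ i, 0 ≤ d i) {a b : ℂ} (ha : 0 < a.re)
    (hb : 0 < b.re) (hab : a ≠ b) :
    ‖(fixedPointDenom d P z a)⁻¹ - (fixedPointDenom d P z b)⁻¹‖ ^ 2 /
        ((fixedPointDenom d P z a)⁻¹.re * (fixedPointDenom d P z b)⁻¹.re) <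
      ‖a - b‖ ^ 2 / (a.re * b.re) := by
  have h1 := re_fixedPointDenom_ge (P := P) (z := z) hd ha.le
  have h2 := re_fixedPointDenom_ge (P := P) (z := z) hd hb.le
  have h3 := norm_fixedPointDenom_sub_sq_le (P := P) (z := z) hd ha.le hb.le
  have h4 := weightEnergy_nonneg (d := d) (P := P) a
  have h5 := weightEnergy_nonneg (d := d) (P := P) b
  set A := fixedPointDenom d P z a
  set B := fixedPointDenom d P z b
  set S := weightEnergy d P a
  set T := weightEnergy d P b
  have hA : 0 < A.re := by nlinarith
  have hB : 0 < B.re := by nlinarith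
  have hA0 : A ≠ 0 := fun h => by simp [h] at hA
  have hB0 : B ≠ 0 := fun h => by simp [h] at hB
  have hA1 := norm_pos_iff.2 hA0
  have hB1 := norm_pos_iff.2 hB0
  have hab' : 0 < ‖a - b‖ := norm_pos_iff.2 (sub_ne_zero.2 hab)
  -- Inversion is a hyperbolic isometry of the right half-plane, so only the denominators need
  -- comparing.
  have e : ‖A⁻¹ - B⁻¹‖ ^ 2 / (A⁻¹.re * B⁻¹.re) = ‖B - A‖ ^ 2 / (A.re * B.re) := by
    rw [inv_sub_inv hA0 hB0, Complex.inv_re, Complex.inv_re, Complex.normSq_eq_norm_sq,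
      Complex.normSq_eq_norm_sq, norm_div, norm_mul]
    field_simp
  rw [e, div_lt_div_iff₀ (by positivity) (by positivity)]
  -- Strictness comes from the summand `-Re z > 0` in the real parts of `A` and `B`.
  have h6 : a.re * S * (b.re * T) < A.re * B.re := by
    have : a.re * S < A.re := by linarith
    have : b.re * T < B.re := by linarith
    have : 0 ≤ a.re * S := by positivity
    have : 0 ≤ b.re * T := by positivity
    nlinarith
  calc ‖B - A‖ ^ 2 * (a.re * b.re) ≤ ‖a - b‖ ^ 2 * (S * T) * (a.re * b.re) := by gcongr
    _ = ‖a - b‖ ^ 2 * (a.re * S * (b.re * T)) := by ring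
    _ < ‖a - b‖ ^ 2 * (A.re * B.re) := by gcongr

/-- The conjugate of the denominator is a nonnegative combination of `-conj z` and of conjugated
inverses of cone elements. -/
lemma inv_fixedPointDenom_mem_spannedCone (hd : ∀ i, 0 ≤ d i) {m : ℂ}
    (hm : m ∈ spannedCone z) (hz : z.re < 0) : (fixedPointDenom d P z m)⁻¹ ∈ spannedCone z := by
  apply inv_mem_spannedCone
  unfold fixedPointDenom
  rw [map_add]
  refine spannedCone_add ((mem_spannedCone_iff hz).2 ⟨0, 1, le_rfl, zero_le_one, by simp⟩) ?_
  have hc : (1 / (P : ℂ)) = ((1 / (P : ℝ) : ℝ) : ℂ) := by push_cast; rfl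
  rw [hc, map_mul, Complex.conj_ofReal, map_sum]
  refine spannedCone_smul (by positivity) (spannedCone_sum _ fun i _ => ?_)
  rw [div_eq_mul_inv, map_mul, Complex.conj_ofReal]
  exact spannedCone_smul (hd i) (conj_inv_mem_spannedCone (one_add_mem_spannedCone (hd i) hm))

/-- Since `Re m = u + v (-Re z)` with both terms nonnegative, a bound on `‖m‖` bounds the cone
coordinates, so the set is a closed piece of the image of a rectangle. -/
lemma isCompact_spannedCone_inter (hz : z.re < 0) (c r : ℝ) :
    IsCompact {m | m ∈ spannedCone z ∧ c ≤ m.re ∧ ‖m‖ ≤ r} := by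
  have hx : 0 < -z.re := by linarith
  have hK : IsCompact ((fun q : ℝ × ℝ => (q.1 : ℂ) - starRingEnd ℂ z * (q.2 : ℂ)) ''
      (Set.Icc (0 : ℝ) r ×ˢ Set.Icc (0 : ℝ) (r / -z.re))) :=
    (isCompact_Icc.prod isCompact_Icc).image (by fun_prop)
  have hC : IsClosed ({m : ℂ | c ≤ m.re} ∩ {m : ℂ | ‖m‖ ≤ r}) :=
    (isClosed_le continuous_const Complex.continuous_re).inter
      (isClosed_le continuous_norm continuous_const)
  convert hK.inter_right hC using 1
  ext m
  simp only [Set.mem_ofPred_eq, Set.mem_inter_iff, Set.mem_image, Prod.exists, Set.mem_prod,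
    Set.mem_Icc]
  refine and_congr_left fun ⟨_, hr⟩ => ?_
  rw [mem_spannedCone_iff hz]
  constructor
  · rintro ⟨u, v, hu, hv, rfl⟩
    have h := (Complex.re_le_norm _).trans hr
    simp at h
    refine ⟨u, v, ⟨⟨hu, by nlinarith⟩, hv, ?_⟩, rfl⟩
    rw [le_div_iff₀ hx]
    linarith
  · rintro ⟨u, v, ⟨⟨hu, _⟩, hv, _⟩, rfl⟩
    exact ⟨u, v, hu, hv, rfl⟩

lemma continuousOn_fixedPointDenom (hd : ∀ i, 0 ≤ d i) :
    ContinuousOn (fixedPointDenom d P z) {m | 0 ≤ m.re} := by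
  unfold fixedPointDenom
  refine continuousOn_const.add (continuousOn_const.mul (continuousOn_finsetSum _ fun i _ => ?_))
  exact continuousOn_const.div (by fun_prop) fun m hm => one_add_ne_zero (hd i) hm

/-- Edelstein's argument: on a compact set the displacement `‖m - F m‖² / (Re m · Re (F m))` attains
its minimum, and strict contraction would lower it further unless `m` is fixed. -/
lemma exists_fixedPoint (hz : z.re < 0) (hd : ∀ i, 0 ≤ d i) :
    ∃ m ∈ spannedCone z, (fixedPointDenom d P z m)⁻¹ = m := by
  have hx : 0 < -z.re := by linarith
  have hS : 0 ≤ (∑ i, d i) / (P : ℝ) := div_nonneg (Finset.sum_nonneg fun i _ => hd i) (by simp)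
  have hz0 := norm_pos_of_re_neg hz
  set D := ‖z‖ + (∑ i, d i) / (P : ℝ)
  have hD : 0 < D := by positivity
  set F : ℂ → ℂ := fun m => (fixedPointDenom d P z m)⁻¹
  -- `F` maps the whole cone into `K`: the denominator has real part at least `-Re z` and modulus at
  -- most `D`.
  set K : Set ℂ := {m | m ∈ spannedCone z ∧ -z.re / D ^ 2 ≤ m.re ∧ ‖m‖ ≤ 1 / -z.re}
  have hre : ∀ m : ℂ, 0 ≤ m.re → -z.re ≤ (fixedPointDenom d P z m).re := fun m hm =>
    (le_add_of_nonneg_right (mul_nonneg hm (weightEnergy_nonneg m))).trans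
      (re_fixedPointDenom_ge hd hm)
  have hne : ∀ m : ℂ, 0 ≤ m.re → fixedPointDenom d P z m ≠ 0 := fun m hm h => by
    have := hre m hm
    simp [h] at this
    linarith
  have hF : ∀ m ∈ spannedCone z, F m ∈ K := fun m hm => by
    have hm0 := re_nonneg_of_mem_spannedCone hz hm
    have h1 := hre m hm0
    have h2 : ‖fixedPointDenom d P z m‖ ≤ D := norm_fixedPointDenom_le hd hm0
    have h3 := norm_pos_iff.2 (hne m hm0)
    refine ⟨inv_fixedPointDenom_mem_spannedCone hd hm hz, ?_, ?_⟩
    · simp only [F]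
      rw [Complex.inv_re, Complex.normSq_eq_norm_sq]
      gcongr
      linarith
    · simp only [F]
      rw [norm_inv, ← one_div]
      exact one_div_le_one_div_of_le hx (h1.trans (Complex.re_le_norm _))
  have hKpos : ∀ m ∈ K, 0 < m.re := fun m hm =>
    (show 0 < -z.re / D ^ 2 by positivity).trans_le hm.2.1
  have hFc : ContinuousOn F K :=
    ((continuousOn_fixedPointDenom hd).mono fun m hm => (hKpos m hm).le).inv₀
      fun m hm => hne m (hKpos m hm).le
  have hδ : ContinuousOn (fun m => ‖m - F m‖ ^ 2 / (m.re * (F m).re)) K := by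
    refine ContinuousOn.div ?_ ?_ ?_
    · exact ((continuousOn_id.sub hFc).norm).pow 2
    · exact Complex.continuous_re.continuousOn.mul (Complex.continuous_re.comp_continuousOn hFc)
    · exact fun m hm => (mul_pos (hKpos m hm) (hKpos _ (hF m hm.1))).ne'
  obtain ⟨m, hm, hmin⟩ := (isCompact_spannedCone_inter hz _ _).exists_isMinOn
    ⟨F 1, hF 1 (by simpa using ofReal_mem_spannedCone (z := z) zero_le_one)⟩ hδ
  refine ⟨m, hm.1, ?_⟩
  by_contra hne'
  have h1 := fixedPoint_strict_contraction (P := P) hz hd (hKpos m hm) (hKpos _ (hF m hm.1))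
    (Ne.symm hne')
  exact absurd (hmin (hF m hm.1)) (not_le.2 h1)

lemma exists_isConeSolution (hz : z.re < 0) {N P : ℕ} (hN : 0 < N) (hP : 0 < P) {d : Fin N → ℝ}
    (hd : ∀ i, 0 ≤ d i) : ∃ m, IsConeSolution d ((P : ℝ) / N) z m := by
  obtain ⟨m, hm, h⟩ := exists_fixedPoint (P := P) hz hd
  refine ⟨m, (isConeSolution_iff hN d m).2 ⟨hm, ?_⟩⟩
  have hm0 := re_nonneg_of_mem_spannedCone hz hm
  have hP' : (P : ℂ) ≠ 0 := by exact_mod_cast hP.ne'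
  have h0 : fixedPointDenom d P z m ≠ 0 := fun h0 => by
    have := re_fixedPointDenom_ge (P := P) (z := z) hd hm0
    have := mul_nonneg hm0 (weightEnergy_nonneg (d := d) (P := P) m)
    simp [h0] at *
    linarith
  have h1 : fixedPointDenom d P z m * m = 1 := by
    nth_rewrite 2 [← h]
    exact mul_inv_cancel₀ h0
  unfold fixedPointDenom at h1
  have h2 : ∑ i, (d i : ℂ) * m / (1 + (d i : ℂ) * m) =
      (∑ i, (d i : ℂ) / (1 + (d i : ℂ) * m)) * m := by
    rw [Finset.sum_mul]
    exact Finset.sum_congr rfl fun i _ => by ring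
  rw [h2]
  field_simp at h1
  linear_combination -h1

/-- A lower bound for the modulus of the cone solution. -/
lemma norm_inv_isConeSolution_le (hz : z.re < 0) {N P : ℕ} (hN : 0 < N) (hP : 0 < P)
    {d : Fin N → ℝ} (hd : ∀ i, 0 ≤ d i) {m : ℂ} (h : IsConeSolution d ((P : ℝ) / N) z m) :
    m ≠ 0 ∧ ‖m‖⁻¹ ≤ ‖z‖ + (∑ i, d i) / P := by
  obtain ⟨hm, h⟩ := (isConeSolution_iff hN d m).1 h
  have hP' : (P : ℂ) ≠ 0 := by exact_mod_cast hP.ne'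
  have hm0 : m ≠ 0 := by
    rintro rfl
    simp at h
    omega
  refine ⟨hm0, ?_⟩
  have h1 : m⁻¹ = fixedPointDenom d P z m := by
    have h2 : ∑ i, (d i : ℂ) * m / (1 + (d i : ℂ) * m) =
        (∑ i, (d i : ℂ) / (1 + (d i : ℂ) * m)) * m := by
      rw [Finset.sum_mul]
      exact Finset.sum_congr rfl fun i _ => by ring
    rw [h2] at h
    unfold fixedPointDenom
    generalize ∑ i, (d i : ℂ) / (1 + (d i : ℂ) * m) = T at h ⊢
    field_simp
    linear_combination h
  rw [← norm_inv, h1]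
  exact norm_fixedPointDenom_le hd (re_nonneg_of_mem_spannedCone hz hm)

end FixedPoint

open scoped ComplexOrder Matrix

/-! ### Resolvents of positive semidefinite matrices -/

section Resolvent

variable {n : Type*} [Fintype n] {B : Matrix n n ℂ} {z : ℂ}

/-- The squared Euclidean norm of a complex vector. -/
noncomputable def euclideanSq (u : n → ℂ) : ℝ := ∑ p, ‖u p‖ ^ 2

lemma euclideanSq_nonneg (u : n → ℂ) : 0 ≤ euclideanSq u := by
  unfold euclideanSq; positivity

lemma star_dotProduct_self_eq (u : n → ℂ) : star u ⬝ᵥ u = (euclideanSq u : ℂ) := by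
  simp [euclideanSq, dotProduct, ← Complex.normSq_eq_norm_sq, Complex.normSq_eq_conj_mul_self]

lemma re_star_dotProduct_le (u v : n → ℂ) {x : ℝ} (hx : 0 < x) :
    (star u ⬝ᵥ v).re ≤ x / 2 * euclideanSq u + 1 / (2 * x) * euclideanSq v := by
  unfold euclideanSq dotProduct
  rw [Complex.re_sum, Finset.mul_sum, Finset.mul_sum, ← Finset.sum_add_distrib]
  refine Finset.sum_le_sum fun p _ => (Complex.re_le_norm _).trans ?_
  rw [norm_mul, Pi.star_apply, norm_star]
  have : 0 ≤ (x * ‖u p‖ - ‖v p‖) ^ 2 / (2 * x) := by positivity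
  have e : (x * ‖u p‖ - ‖v p‖) ^ 2 / (2 * x) =
      x / 2 * ‖u p‖ ^ 2 + 1 / (2 * x) * ‖v p‖ ^ 2 - ‖u p‖ * ‖v p‖ := by
    field_simp
    ring
  linarith

variable [DecidableEq n]

lemma star_dotProduct_shift_mulVec (hB : B.PosSemidef) (z : ℂ) (u : n → ℂ) :
    ∃ β : ℝ, 0 ≤ β ∧ star u ⬝ᵥ ((B - z • 1) *ᵥ u) = (β : ℂ) - z * (euclideanSq u : ℂ) := by
  have h := hB.dotProduct_mulVec_nonneg u
  obtain ⟨h1, h2⟩ := Complex.nonneg_iff.1 h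
  refine ⟨(star u ⬝ᵥ (B *ᵥ u)).re, h1, ?_⟩
  rw [Matrix.sub_mulVec, dotProduct_sub, Matrix.smul_mulVec, Matrix.one_mulVec, dotProduct_smul,
    star_dotProduct_self_eq, smul_eq_mul]
  congr 1
  exact Complex.ext rfl h2.symm

/-- Coercivity: the form of `B - z` at `u` has real part at least `-Re z` times `|u|²`. Young's
inequality with weight `-Re z` absorbs half of this. -/
lemma euclideanSq_le_shift_mulVec (hB : B.PosSemidef) (hz : z.re < 0) (u : n → ℂ) :
    euclideanSq u ≤ euclideanSq ((B - z • 1) *ᵥ u) / z.re ^ 2 := by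
  obtain ⟨β, hβ, h⟩ := star_dotProduct_shift_mulVec hB z u
  have hx : 0 < -z.re := by linarith
  have h1 := re_star_dotProduct_le u ((B - z • 1) *ᵥ u) hx
  rw [h] at h1
  simp only [Complex.sub_re, Complex.ofReal_re, Complex.mul_re, Complex.ofReal_im, mul_zero,
    sub_zero] at h1
  set V := euclideanSq ((B - z • 1) *ᵥ u)
  have h2 : -z.re / 2 * euclideanSq u ≤ 1 / (2 * -z.re) * V := by linarith
  rw [le_div_iff₀ (by nlinarith)]
  have h3 := mul_le_mul_of_nonneg_left h2 (show 0 ≤ 2 * -z.re by linarith)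
  have e : 2 * -z.re * (1 / (2 * -z.re) * V) = V := by
    rw [← mul_assoc, mul_one_div_cancel (by linarith), one_mul]
  rw [e] at h3
  linarith

lemma isUnit_shift (hB : B.PosSemidef) (hz : z.re < 0) : IsUnit (B - z • 1) := by
  rw [← Matrix.mulVec_injective_iff_isUnit]
  intro u v huv
  have h := euclideanSq_le_shift_mulVec hB hz (u - v)
  have h0 : (B - z • 1) *ᵥ (u - v) = 0 := by
    rw [Matrix.mulVec_sub]
    exact sub_eq_zero.2 huv
  have h1 : euclideanSq (u - v) ≤ 0 := by
    rw [h0] at h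
    simpa [euclideanSq] using h
  have h2 := (Finset.sum_eq_zero_iff_of_nonneg (fun p _ => by positivity)).1
    (le_antisymm h1 (euclideanSq_nonneg _))
  funext p
  have := h2 p (Finset.mem_univ p)
  simpa [sub_eq_zero] using this

lemma shift_mulVec_inv_mulVec (hB : B.PosSemidef) (hz : z.re < 0) (v : n → ℂ) :
    (B - z • 1) *ᵥ ((B - z • 1)⁻¹ *ᵥ v) = v := by
  rw [Matrix.mulVec_mulVec, Matrix.mul_nonsing_inv _
    ((Matrix.isUnit_iff_isUnit_det _).1 (isUnit_shift hB hz)), Matrix.one_mulVec]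

lemma euclideanSq_inv_mulVec_le (hB : B.PosSemidef) (hz : z.re < 0) (v : n → ℂ) :
    euclideanSq ((B - z • 1)⁻¹ *ᵥ v) ≤ euclideanSq v / z.re ^ 2 := by
  have h := euclideanSq_le_shift_mulVec hB hz ((B - z • 1)⁻¹ *ᵥ v)
  rwa [shift_mulVec_inv_mulVec hB hz] at h

/-- The quadratic form of the resolvent at a real vector. -/
lemma dotProduct_inv_mulVec (hB : B.PosSemidef) (hz : z.re < 0) {v : n → ℂ} (hv : star v = v) :
    ∃ β : ℝ, 0 ≤ β ∧ v ⬝ᵥ ((B - z • 1)⁻¹ *ᵥ v) =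
      (β : ℂ) - starRingEnd ℂ z * (euclideanSq ((B - z • 1)⁻¹ *ᵥ v) : ℂ) := by
  -- With `u` the resolvent applied to `v`, the form of `B - z` at `u` is `star u ⬝ᵥ v`; as `v` is
  -- real, its conjugate is the wanted quantity.
  obtain ⟨β, hβ, h⟩ := star_dotProduct_shift_mulVec hB z ((B - z • 1)⁻¹ *ᵥ v)
  refine ⟨β, hβ, ?_⟩
  rw [shift_mulVec_inv_mulVec hB hz] at h
  have h' := congrArg star h
  rw [Matrix.star_dotProduct, star_star, hv] at h'
  rw [h']
  simp

/-- Each column is the resolvent applied to a unit vector. -/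
lemma sum_norm_sq_inv_le (hB : B.PosSemidef) (hz : z.re < 0) :
    ∑ p, ∑ q, ‖(B - z • 1)⁻¹ p q‖ ^ 2 ≤ Fintype.card n / z.re ^ 2 := by
  rw [Finset.sum_comm]
  have h : ∀ q : n, ∑ p, ‖(B - z • 1)⁻¹ p q‖ ^ 2 ≤ 1 / z.re ^ 2 := fun q => by
    have h := euclideanSq_inv_mulVec_le hB hz (Pi.single q 1)
    have e : euclideanSq (Pi.single q 1 : n → ℂ) = 1 := by
      unfold euclideanSq
      rw [Finset.sum_eq_single q]
      · simp
      · intro p _ hp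
        simp [hp]
      · simp
    rw [e] at h
    simpa [euclideanSq] using h
  refine (Finset.sum_le_sum fun q _ => h q).trans ?_
  simp [div_eq_mul_inv]

lemma norm_inv_apply_le (hB : B.PosSemidef) (hz : z.re < 0) (p q : n) :
    ‖(B - z • 1)⁻¹ p q‖ ≤ 1 / -z.re := by
  have h := euclideanSq_inv_mulVec_le hB hz (Pi.single q 1)
  have e : euclideanSq (Pi.single q 1 : n → ℂ) = 1 := by
    unfold euclideanSq
    rw [Finset.sum_eq_single q]
    · simp
    · intro p _ hp
      simp [hp]
    · simp
  rw [e] at h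
  have h1 : ‖(B - z • 1)⁻¹ p q‖ ^ 2 ≤ euclideanSq ((B - z • 1)⁻¹ *ᵥ (Pi.single q 1)) := by
    unfold euclideanSq
    simpa using Finset.single_le_sum (f := fun p => ‖(B - z • 1)⁻¹ p q‖ ^ 2)
      (fun _ _ => by positivity) (Finset.mem_univ p)
  have hx : 0 < -z.re := by linarith
  refine (sq_le_sq₀ (norm_nonneg _) (by positivity)).1 (h1.trans (h.trans_eq ?_))
  rw [div_pow, neg_sq, one_pow]

lemma inv_shift_isSymm (hs : B.IsSymm) : ((B - z • 1)⁻¹).IsSymm := by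
  unfold Matrix.IsSymm
  rw [Matrix.transpose_nonsing_inv, Matrix.transpose_sub, hs.eq, Matrix.transpose_smul,
    Matrix.transpose_one]

/-- Sherman-Morrison for a real rank-one perturbation. -/
lemma one_add_mul_inv_mulVec {C : Matrix n n ℂ} {c : ℂ} {v : n → ℂ}
    (hB : B.PosSemidef) (hC : C.PosSemidef) (hz : z.re < 0)
    (hBC : B = C + c • Matrix.vecMulVec v v) :
    (1 + c * (v ⬝ᵥ ((C - z • 1)⁻¹ *ᵥ v))) • ((B - z • 1)⁻¹ *ᵥ v) = (C - z • 1)⁻¹ *ᵥ v := by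
  have h1 : (B - z • 1) *ᵥ ((C - z • 1)⁻¹ *ᵥ v) =
      (1 + c * (v ⬝ᵥ ((C - z • 1)⁻¹ *ᵥ v))) • v := by
    have : B - z • 1 = (C - z • 1) + c • Matrix.vecMulVec v v := by rw [hBC]; abel
    rw [this, Matrix.add_mulVec, shift_mulVec_inv_mulVec hC hz, Matrix.smul_mulVec,
      Matrix.vecMulVec_mulVec, add_smul, one_smul, op_smul_eq_smul, smul_smul]
  rw [← Matrix.mulVec_smul, ← h1, Matrix.mulVec_mulVec, Matrix.nonsing_inv_mul _
    ((Matrix.isUnit_iff_isUnit_det _).1 (isUnit_shift hB hz)), Matrix.one_mulVec]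

/-- A positive rank-one perturbation changes the trace of the resolvent by a bounded amount. -/
lemma norm_trace_inv_sub_le {C : Matrix n n ℂ} {c : ℝ} {v : n → ℂ}
    (hB : B.PosSemidef) (hC : C.PosSemidef) (hBs : B.IsSymm) (hz : z.re < 0)
    (hc : 0 ≤ c) (hv : star v = v) (hBC : B = C + (c : ℂ) • Matrix.vecMulVec v v) :
    ‖((C - z • 1)⁻¹).trace - ((B - z • 1)⁻¹).trace‖ ≤ 1 / -z.re := by
  have hx : 0 < -z.re := by linarith
  have hsm := one_add_mul_inv_mulVec hB hC hz hBC
  obtain ⟨β, hβ, hg⟩ := dotProduct_inv_mulVec hC hz hv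
  set R := (C - z • 1)⁻¹
  set u := R *ᵥ v
  have hUB := (Matrix.isUnit_iff_isUnit_det _).1 (isUnit_shift hB hz)
  have hUC := (Matrix.isUnit_iff_isUnit_det _).1 (isUnit_shift hC hz)
  have h1 : R - (B - z • 1)⁻¹ = (c : ℂ) • Matrix.vecMulVec u (v ᵥ* (B - z • 1)⁻¹) := by
    have e : B - z • 1 - (C - z • 1) = (c : ℂ) • Matrix.vecMulVec v v := by rw [hBC]; abel
    calc R - (B - z • 1)⁻¹
        = R * (B - z • 1 - (C - z • 1)) * (B - z • 1)⁻¹ := by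
          rw [mul_sub, sub_mul, mul_assoc, Matrix.mul_nonsing_inv _ hUB, mul_one,
            Matrix.nonsing_inv_mul _ hUC, one_mul]
      _ = _ := by
          rw [e, mul_smul_comm, smul_mul_assoc, Matrix.mul_vecMulVec, Matrix.vecMulVec_mul]
  have hρ := euclideanSq_nonneg u
  set ρ := euclideanSq u
  have huu : ‖u ⬝ᵥ u‖ ≤ ρ := by
    refine (norm_sum_le _ _).trans (le_of_eq ?_)
    simp [ρ, euclideanSq, sq]
  have hS : v ᵥ* (B - z • 1)⁻¹ = (B - z • 1)⁻¹ *ᵥ v := by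
    rw [← Matrix.mulVec_transpose, (inv_shift_isSymm hBs).eq]
  set g := v ⬝ᵥ u
  have h2 : (1 + (c : ℂ) * g) * (R.trace - ((B - z • 1)⁻¹).trace) = c * (u ⬝ᵥ u) := by
    rw [← Matrix.trace_sub, h1, Matrix.trace_smul, Matrix.trace_vecMulVec, smul_eq_mul,
      mul_left_comm, hS, ← smul_eq_mul (1 + _), ← dotProduct_smul, hsm]
  -- The same `ρ` bounds the numerator `u ⬝ᵥ u` and appears in `Re g`, so the quotient is bounded
  -- independently of `c` and `v`.
  have h3 : c * ρ * -z.re ≤ ‖1 + (c : ℂ) * g‖ := by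
    refine le_trans ?_ (Complex.re_le_norm _)
    rw [hg]
    simp
    nlinarith [mul_nonneg hc hβ]
  have h4 : 0 < ‖1 + (c : ℂ) * g‖ := by
    refine zero_lt_one.trans_le (one_le_norm_one_add hc ?_)
    rw [hg]
    simp
    nlinarith
  have h5 := congrArg norm h2
  rw [norm_mul, norm_mul, Complex.norm_real, Real.norm_of_nonneg hc] at h5
  refine le_of_mul_le_mul_left ?_ h4
  rw [h5, mul_one_div, le_div_iff₀ hx]
  refine le_trans ?_ h3
  gcongr

end Resolvent

/-! ### The Wishart resolvent and the leave-one-out identity -/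

section Wishart

variable {P N : ℕ}

/-- The generalized Wishart matrix, with complex entries. -/
noncomputable def complexWishart (d : Fin N → ℝ) (W : Matrix (Fin P) (Fin N) ℝ) :
    Matrix (Fin P) (Fin P) ℂ :=
  (generalizedWishart (Matrix.diagonal d) W).map Complex.ofReal

/-- The resolvent of the generalized Wishart matrix. -/
noncomputable def wishartResolvent (d : Fin N → ℝ) (W : Matrix (Fin P) (Fin N) ℝ) (z : ℂ) :
    Matrix (Fin P) (Fin P) ℂ :=
  (complexWishart d W - z • (1 : Matrix (Fin P) (Fin P) ℂ))⁻¹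

/-- A column of a real matrix, with complex entries. -/
def complexCol (W : Matrix (Fin P) (Fin N) ℝ) (i : Fin N) : Fin P → ℂ := fun p => (W p i : ℂ)

/-- The normalized quadratic form at a column of the resolvent without that column. -/
noncomputable def cavityForm (d : Fin N → ℝ) (W : Matrix (Fin P) (Fin N) ℝ) (z : ℂ) (i : Fin N) :
    ℂ :=
  1 / (P : ℂ) *
    (complexCol W i ⬝ᵥ (wishartResolvent (Function.update d i 0) W z *ᵥ complexCol W i))

/-- The normalized trace of the resolvent without a column. -/
noncomputable def cavityTrace (d : Fin N → ℝ) (W : Matrix (Fin P) (Fin N) ℝ) (z : ℂ) (i : Fin N) :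
    ℂ :=
  stieltjesTransform (Matrix.diagonal (Function.update d i 0)) W z

variable {d : Fin N → ℝ} {W : Matrix (Fin P) (Fin N) ℝ} {z : ℂ}

lemma stieltjesTransform_eq :
    stieltjesTransform (Matrix.diagonal d) W z = 1 / (P : ℂ) * (wishartResolvent d W z).trace :=
  rfl

lemma star_complexCol (i : Fin N) : star (complexCol W i) = complexCol W i := by
  funext p
  simp [complexCol]

lemma complexWishart_apply (p q : Fin P) :
    complexWishart d W p q = 1 / (P : ℂ) * ∑ i, (d i : ℂ) * (W p i * W q i) := by
  simp only [complexWishart, generalizedWishart, Matrix.map_apply, Matrix.smul_apply,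
    Matrix.mul_apply (N := W.transpose), Matrix.mul_diagonal, Matrix.transpose_apply, smul_eq_mul]
  push_cast
  congr 1
  exact Finset.sum_congr rfl fun i _ => by ring

lemma complexWishart_eq_sum :
    complexWishart d W =
      ∑ i, ((d i / P : ℝ) : ℂ) • Matrix.vecMulVec (complexCol W i) (complexCol W i) := by
  ext p q
  rw [complexWishart_apply, Matrix.sum_apply, Finset.mul_sum]
  refine Finset.sum_congr rfl fun i _ => ?_
  simp [Matrix.vecMulVec_apply, complexCol]
  ring

lemma complexWishart_posSemidef (hd : ∀ i, 0 ≤ d i) : (complexWishart d W).PosSemidef := by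
  rw [complexWishart_eq_sum]
  refine Matrix.posSemidef_sum _ fun i _ => ?_
  have h := Matrix.posSemidef_vecMulVec_self_star (complexCol W i)
  rw [star_complexCol] at h
  exact h.smul (Complex.zero_le_real.2 (div_nonneg (hd i) P.cast_nonneg))

lemma complexWishart_isSymm : (complexWishart d W).IsSymm := by
  ext p q
  rw [Matrix.transpose_apply, complexWishart_apply, complexWishart_apply]
  simp only [mul_comm (W q _ : ℂ)]

lemma complexWishart_eq_update_add (i : Fin N) :
    complexWishart d W = complexWishart (Function.update d i 0) W +
      ((d i / P : ℝ) : ℂ) • Matrix.vecMulVec (complexCol W i) (complexCol W i) := by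
  rw [complexWishart_eq_sum, complexWishart_eq_sum, ← Finset.add_sum_erase _ _ (Finset.mem_univ i),
    ← Finset.add_sum_erase (a := i) _ (fun j => ((Function.update d i 0 j / P : ℝ) : ℂ) • _)
      (Finset.mem_univ i), add_comm]
  congr 1
  simp only [Function.update_self, zero_div, Complex.ofReal_zero, zero_smul, zero_add]
  refine Finset.sum_congr rfl fun j hj => ?_
  rw [Function.update_of_ne (Finset.ne_of_mem_erase hj)]

lemma update_zero_nonneg (hd : ∀ i, 0 ≤ d i) (i j : Fin N) : 0 ≤ Function.update d i 0 j := by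
  by_cases h : j = i
  · simp [h]
  · simpa [h] using hd j

/-- The resolvent without a column does not depend on that column. -/
lemma wishartResolvent_update_congr {W' : Matrix (Fin P) (Fin N) ℝ} (i : Fin N)
    (h : ∀ p j, j ≠ i → W p j = W' p j) :
    wishartResolvent (Function.update d i 0) W z =
      wishartResolvent (Function.update d i 0) W' z := by
  unfold wishartResolvent
  congr 2
  ext p q
  rw [complexWishart_apply, complexWishart_apply]
  congr 1
  refine Finset.sum_congr rfl fun j _ => ?_
  by_cases hj : j = i
  · simp [hj]
  · rw [h p j hj, h q j hj]

lemma sub_conj_mul_mem_spannedCone (hz : z.re < 0) {u v : ℝ} (hu : 0 ≤ u) (hv : 0 ≤ v) :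
    (u : ℂ) - starRingEnd ℂ z * (v : ℂ) ∈ spannedCone z :=
  (mem_spannedCone_iff hz).2 ⟨u, v, hu, hv, rfl⟩

lemma cavityForm_mem_spannedCone (hz : z.re < 0) (hd : ∀ i, 0 ≤ d i) (i : Fin N) :
    cavityForm d W z i ∈ spannedCone z := by
  obtain ⟨β, hβ, h⟩ := dotProduct_inv_mulVec
    (complexWishart_posSemidef (W := W) (update_zero_nonneg hd i)) hz (star_complexCol (W := W) i)
  have hc : (1 / (P : ℂ)) = ((1 / (P : ℝ) : ℝ) : ℂ) := by push_cast; rfl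
  unfold cavityForm wishartResolvent
  rw [h, hc]
  exact spannedCone_smul (by positivity) (sub_conj_mul_mem_spannedCone hz hβ (euclideanSq_nonneg _))

lemma stieltjesTransform_mem_spannedCone (hz : z.re < 0) (hd : ∀ i, 0 ≤ d i) :
    stieltjesTransform (Matrix.diagonal d) W z ∈ spannedCone z := by
  have hc : (1 / (P : ℂ)) = ((1 / (P : ℝ) : ℝ) : ℂ) := by push_cast; rfl
  rw [stieltjesTransform_eq, hc]
  refine spannedCone_smul (by positivity) (spannedCone_sum _ fun p _ => ?_)
  obtain ⟨β, hβ, h⟩ := dotProduct_inv_mulVec (complexWishart_posSemidef (W := W) hd) hz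
    (v := Pi.single p 1) (by simp)
  have e : (wishartResolvent d W z).diag p =
      Pi.single p 1 ⬝ᵥ (wishartResolvent d W z *ᵥ Pi.single p 1) := by simp
  rw [e]
  unfold wishartResolvent
  rw [h]
  exact sub_conj_mul_mem_spannedCone hz hβ (euclideanSq_nonneg _)

lemma norm_wishartResolvent_apply_le (hz : z.re < 0) (hd : ∀ i, 0 ≤ d i) (p q : Fin P) :
    ‖wishartResolvent d W z p q‖ ≤ 1 / -z.re :=
  norm_inv_apply_le (complexWishart_posSemidef hd) hz p q

lemma wishartResolvent_isSymm : (wishartResolvent d W z).IsSymm :=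
  inv_shift_isSymm complexWishart_isSymm

lemma sum_norm_sq_wishartResolvent_le (hz : z.re < 0) (hd : ∀ i, 0 ≤ d i) :
    ∑ p, ∑ q, ‖wishartResolvent d W z p q‖ ^ 2 ≤ P / z.re ^ 2 := by
  have h := sum_norm_sq_inv_le (complexWishart_posSemidef (W := W) hd) hz
  rwa [Fintype.card_fin] at h

lemma norm_cavityTrace_sub_le (hz : z.re < 0) (hd : ∀ i, 0 ≤ d i) (i : Fin N) :
    ‖cavityTrace d W z i - stieltjesTransform (Matrix.diagonal d) W z‖ ≤ 1 / (-z.re * P) := by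
  unfold cavityTrace
  rw [stieltjesTransform_eq, stieltjesTransform_eq, ← mul_sub, norm_mul, norm_div, norm_one,
    Complex.norm_natCast, one_div_mul_eq_div, ← div_div]
  gcongr
  exact norm_trace_inv_sub_le (complexWishart_posSemidef hd)
    (complexWishart_posSemidef (update_zero_nonneg hd i)) complexWishart_isSymm hz
    (div_nonneg (hd i) P.cast_nonneg) (star_complexCol i) (complexWishart_eq_update_add i)

lemma norm_stieltjesTransform_le (hz : z.re < 0) (hd : ∀ i, 0 ≤ d i) :
    ‖stieltjesTransform (Matrix.diagonal d) W z‖ ≤ 1 / -z.re := by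
  have hx : 0 < -z.re := by linarith
  rw [stieltjesTransform_eq, norm_mul, norm_div, norm_one, Complex.norm_natCast, Matrix.trace]
  have h : ‖∑ p, (wishartResolvent d W z).diag p‖ ≤ P * (1 / -z.re) :=
    (norm_sum_le _ _).trans ((Finset.sum_le_sum fun p _ =>
      norm_wishartResolvent_apply_le hz hd p p).trans (by simp))
  refine (mul_le_mul_of_nonneg_left h (by positivity)).trans ?_
  rw [← mul_assoc]
  refine mul_le_of_le_one_left (by positivity) ?_
  rw [one_div_mul_eq_div]
  exact div_self_le_one _

/-- The Stieltjes transform in terms of the leave-one-out quadratic forms. -/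
lemma stieltjesTransform_cavity_eq (hz : z.re < 0) (hP : 0 < P) (hd : ∀ i, 0 ≤ d i) :
    (P : ℂ) + z * P * stieltjesTransform (Matrix.diagonal d) W z =
      ∑ i, (d i : ℂ) * cavityForm d W z i / (1 + (d i : ℂ) * cavityForm d W z i) := by
  have hP' : (P : ℂ) ≠ 0 := by exact_mod_cast hP.ne'
  have hB := complexWishart_posSemidef (W := W) hd
  -- The identity arises by computing this trace twice: from `(B - z) R = 1`, and column by column
  -- from the rank-one decomposition of `B`.
  have h1 : (complexWishart d W * wishartResolvent d W z).trace =
      (P : ℂ) + z * P * stieltjesTransform (Matrix.diagonal d) W z := by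
    have h : (complexWishart d W - z • 1) * wishartResolvent d W z = 1 :=
      Matrix.mul_nonsing_inv _ ((Matrix.isUnit_iff_isUnit_det _).1 (isUnit_shift hB hz))
    rw [sub_mul, sub_eq_iff_eq_add, smul_mul_assoc, one_mul] at h
    rw [h, Matrix.trace_add, Matrix.trace_one, Matrix.trace_smul, stieltjesTransform_eq,
      Fintype.card_fin, smul_eq_mul]
    field_simp
  rw [← h1]
  nth_rewrite 1 [complexWishart_eq_sum]
  rw [Finset.sum_mul, Matrix.trace_sum]
  refine Finset.sum_congr rfl fun i _ => ?_
  have h2 := one_add_mul_inv_mulVec hB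
    (complexWishart_posSemidef (update_zero_nonneg hd i)) hz
    (complexWishart_eq_update_add (d := d) (W := W) i)
  have h3 := congrArg (fun y => complexCol W i ⬝ᵥ y) h2
  simp only [dotProduct_smul, smul_eq_mul] at h3
  have hg : complexCol W i ⬝ᵥ ((complexWishart (Function.update d i 0) W - z • 1)⁻¹ *ᵥ
      complexCol W i) = P * cavityForm d W z i := by
    unfold cavityForm wishartResolvent
    field_simp
  rw [hg] at h3
  have h4 : (((d i / P : ℝ) : ℂ) * (P * cavityForm d W z i)) = d i * cavityForm d W z i := by
    push_cast
    field_simp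
  rw [h4] at h3
  have hne := one_add_ne_zero (hd i) (re_nonneg_of_mem_spannedCone hz
    (cavityForm_mem_spannedCone (W := W) hz hd i))
  rw [smul_mul_assoc, Matrix.vecMulVec_mul, Matrix.trace_smul, Matrix.trace_vecMulVec,
    ← Matrix.mulVec_transpose, wishartResolvent_isSymm.eq, smul_eq_mul, eq_div_iff hne]
  change _ * (complexCol W i ⬝ᵥ ((complexWishart d W - z • 1)⁻¹ *ᵥ complexCol W i)) * _ = _
  push_cast
  rw [mul_assoc, mul_comm (_ ⬝ᵥ _), h3]
  field_simp

lemma continuous_wishartResolvent (hz : z.re < 0) (hd : ∀ i, 0 ≤ d i) :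
    Continuous fun W : Matrix (Fin P) (Fin N) ℝ => wishartResolvent d W z := by
  have hA : Continuous fun W : Matrix (Fin P) (Fin N) ℝ =>
      complexWishart d W - z • (1 : Matrix (Fin P) (Fin P) ℂ) := by
    refine Continuous.sub ?_ continuous_const
    refine continuous_pi fun p => continuous_pi fun q => ?_
    simp only [complexWishart_apply]
    fun_prop
  unfold wishartResolvent
  simp only [Matrix.inv_def, Ring.inverse_eq_inv']
  refine Continuous.smul (Continuous.inv₀ hA.matrix_det fun W => ?_) hA.matrix_adjugate
  exact ((Matrix.isUnit_iff_isUnit_det _).1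
    (isUnit_shift (complexWishart_posSemidef hd) hz)).ne_zero

end Wishart

/-! ### Moments of products of independent Gaussians -/

section GaussianMoments

/-- The fourth moment of the standard Gaussian distribution. -/
noncomputable def gaussianFourthMoment : ℝ := ∫ x, x ^ 4 ∂(gaussianReal 0 1)

lemma gaussianFourthMoment_nonneg : 0 ≤ gaussianFourthMoment :=
  integral_nonneg fun x => by positivity

/-- The centred product of two members of a family of variables. -/
def centredProduct {Ω ι : Type*} [DecidableEq ι] (X : ι → Ω → ℝ) (a : ι × ι) (ω : Ω) : ℝ :=
  X a.1 ω * X a.2 ω - if a.1 = a.2 then 1 else 0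

lemma centredProduct_mul_eq {Ω ι : Type*} [DecidableEq ι] (X : ι → Ω → ℝ) (a b : ι × ι) (ω : Ω) :
    centredProduct X a ω * centredProduct X b ω =
      X a.1 ω * X a.2 ω * (X b.1 ω * X b.2 ω) - (if a.1 = a.2 then 1 else 0) * (X b.1 ω * X b.2 ω)
        - (if b.1 = b.2 then 1 else 0) * centredProduct X a ω := by
  unfold centredProduct
  ring

/-- Independent measurable standard Gaussian variables. -/
structure IsStdGaussianFamily {Ω ι : Type*} [MeasurableSpace Ω] (X : ι → Ω → ℝ) (μ : Measure Ω) :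
    Prop where
  measurable : ∀ p, Measurable (X p)
  hasLaw : ∀ p, HasLaw (X p) (gaussianReal 0 1) μ
  iIndepFun : iIndepFun X μ

namespace IsStdGaussianFamily

variable {Ω ι : Type*} [MeasurableSpace Ω] {μ : Measure Ω} {X : ι → Ω → ℝ}

lemma integral_eq_zero (h : IsStdGaussianFamily X μ) (p : ι) : ∫ ω, X p ω ∂μ = 0 := by
  rw [(h.hasLaw p).integral_eq, integral_id_gaussianReal]

lemma integral_sq (h : IsStdGaussianFamily X μ) (p : ι) : ∫ ω, X p ω * X p ω ∂μ = 1 := by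
  have h1 := (h.hasLaw p).integral_comp (f := fun x => x * x) (by fun_prop)
  have h2 := variance_eq_sub (memLp_id_gaussianReal (μ := 0) (v := 1) 2)
  simp only [variance_id_gaussianReal, Pi.pow_apply, id, integral_id_gaussianReal] at h2
  refine h1.trans ?_
  simp only [← sq]
  simpa using h2.symm

lemma integral_fourth (h : IsStdGaussianFamily X μ) (p : ι) :
    ∫ ω, X p ω * X p ω * (X p ω * X p ω) ∂μ = gaussianFourthMoment := by
  have h1 := (h.hasLaw p).integral_comp (f := fun x => x ^ 4) (by fun_prop)
  refine Eq.trans ?_ h1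
  exact integral_congr_ae (.of_forall fun ω => by simp only [Function.comp]; ring)

lemma integrable_pow_four (h : IsStdGaussianFamily X μ) (p : ι) :
    Integrable (fun ω => X p ω ^ 4) μ := by
  have h1 := (memLp_id_gaussianReal (μ := 0) (v := 1) 4).integrable_norm_pow (p := 4) (by simp)
  rw [← (h.hasLaw p).map_eq] at h1
  have h2 := (integrable_map_measure (by fun_prop) (h.measurable p).aemeasurable).1 h1
  refine h2.congr (.of_forall fun ω => ?_)
  simp [Function.comp, Even.pow_abs (show Even 4 by decide)]

lemma integrable_mul_four (h : IsStdGaussianFamily X μ) (p q r s : ι) :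
    Integrable (fun ω => X p ω * X q ω * (X r ω * X s ω)) μ := by
  have hm := h.measurable
  refine Integrable.mono' ((((h.integrable_pow_four p).add (h.integrable_pow_four q)).add
    (h.integrable_pow_four r)).add (h.integrable_pow_four s))
    (by fun_prop) (.of_forall fun ω => ?_)
  simp only [Pi.add_apply, Real.norm_eq_abs]
  rw [abs_le]
  constructor <;>
  nlinarith [sq_nonneg (X p ω * X q ω + X r ω * X s ω), sq_nonneg (X p ω * X q ω - X r ω * X s ω),
    sq_nonneg (X p ω ^ 2 - X q ω ^ 2), sq_nonneg (X r ω ^ 2 - X s ω ^ 2),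
    sq_nonneg (X p ω ^ 2), sq_nonneg (X q ω ^ 2), sq_nonneg (X r ω ^ 2), sq_nonneg (X s ω ^ 2)]

lemma integrable_mul_two [IsFiniteMeasure μ] (h : IsStdGaussianFamily X μ) (p q : ι) :
    Integrable (fun ω => X p ω * X q ω) μ := by
  have hm := h.measurable
  refine Integrable.mono' ((h.integrable_mul_four p q p q).add (integrable_const 1))
    (by fun_prop) (.of_forall fun ω => ?_)
  simp only [Pi.add_apply, Real.norm_eq_abs]
  rw [abs_le]
  constructor <;> nlinarith [sq_nonneg (X p ω * X q ω + 1), sq_nonneg (X p ω * X q ω - 1)]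

lemma integral_mul_of_ne (h : IsStdGaussianFamily X μ) {p q : ι} (hpq : p ≠ q) :
    ∫ ω, X p ω * X q ω ∂μ = 0 := by
  rw [(h.iIndepFun.indepFun hpq).integral_fun_mul_eq_mul_integral
    (h.measurable p).aestronglyMeasurable (h.measurable q).aestronglyMeasurable,
    h.integral_eq_zero, zero_mul]

lemma integral_mul_mul_of_ne (h : IsStdGaussianFamily X μ) {p q : ι} (hpq : p ≠ q) :
    ∫ ω, X p ω * X p ω * (X q ω * X q ω) ∂μ = 1 := by
  rw [(h.iIndepFun.indepFun hpq).integral_fun_comp_mul_comp (f := fun x => x * x)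
    (g := fun x => x * x) (h.measurable p).aemeasurable (h.measurable q).aemeasurable
    (by fun_prop) (by fun_prop), h.integral_sq, h.integral_sq, one_mul]

/-- An index occurring once factors out with mean zero. The other three may coincide, so
independence is used between `{p}` and the finset `{q, r, s}`. -/
lemma integral_four_of_ne (h : IsStdGaussianFamily X μ) {p q r s : ι}
    (hq : p ≠ q) (hr : p ≠ r) (hs : p ≠ s) :
    ∫ ω, X p ω * (X q ω * X r ω * X s ω) ∂μ = 0 := by
  classical
  have hm := h.measurable
  have hd : Disjoint ({p} : Finset ι) {q, r, s} := by simp [hq, hr, hs]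
  have hφ : Measurable fun y : ({p} : Finset ι) → ℝ => y ⟨p, by simp⟩ := measurable_pi_apply _
  have hψ : Measurable fun y : ({q, r, s} : Finset ι) → ℝ =>
      y ⟨q, by simp⟩ * y ⟨r, by simp⟩ * y ⟨s, by simp⟩ := by fun_prop
  have hi := (h.iIndepFun.indepFun_finset _ _ hd hm).comp hφ hψ
  have h1 := hi.integral_fun_mul_eq_mul_integral (by simp only [Function.comp_def]; fun_prop)
    (by simp only [Function.comp_def]; fun_prop)
  simp only [Function.comp_def] at h1
  rw [h1, h.integral_eq_zero, zero_mul]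

variable [DecidableEq ι]

lemma integral_mul_two (h : IsStdGaussianFamily X μ) (p q : ι) :
    ∫ ω, X p ω * X q ω ∂μ = if p = q then 1 else 0 := by
  split_ifs with hpq
  · rw [hpq, h.integral_sq]
  · exact h.integral_mul_of_ne hpq

variable [IsProbabilityMeasure μ]

lemma integrable_centredProduct (h : IsStdGaussianFamily X μ) (a : ι × ι) :
    Integrable (centredProduct X a) μ :=
  (h.integrable_mul_two _ _).sub (integrable_const _)

lemma integral_centredProduct (h : IsStdGaussianFamily X μ) (a : ι × ι) :
    ∫ ω, centredProduct X a ω ∂μ = 0 := by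
  unfold centredProduct
  rw [integral_sub (h.integrable_mul_two _ _) (integrable_const _), h.integral_mul_two]
  simp

lemma integrable_centredProduct_mul (h : IsStdGaussianFamily X μ) (a b : ι × ι) :
    Integrable (fun ω => centredProduct X a ω * centredProduct X b ω) μ := by
  simp only [centredProduct_mul_eq]
  exact ((h.integrable_mul_four _ _ _ _).sub ((h.integrable_mul_two _ _).const_mul _)).sub
    ((h.integrable_centredProduct a).const_mul _)

lemma integral_centredProduct_mul (h : IsStdGaussianFamily X μ) (a b : ι × ι) :
    ∫ ω, centredProduct X a ω * centredProduct X b ω ∂μ =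
      ∫ ω, X a.1 ω * X a.2 ω * (X b.1 ω * X b.2 ω) ∂μ -
        (if a.1 = a.2 then 1 else 0) * (if b.1 = b.2 then 1 else 0) := by
  simp only [centredProduct_mul_eq]
  rw [integral_sub (f := fun ω => X a.1 ω * X a.2 ω * (X b.1 ω * X b.2 ω) -
    (if a.1 = a.2 then 1 else 0) * (X b.1 ω * X b.2 ω))
    ((h.integrable_mul_four _ _ _ _).sub ((h.integrable_mul_two _ _).const_mul _))
    ((h.integrable_centredProduct a).const_mul _), integral_sub (h.integrable_mul_four _ _ _ _)
    ((h.integrable_mul_two _ _).const_mul _), integral_const_mul, integral_const_mul,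
    h.integral_centredProduct, h.integral_mul_two, mul_zero, sub_zero]

/-- Near-orthogonality: distinct unordered index pairs are uncorrelated. The factor only has to
dominate the two nonzero values, `1` and the fourth moment minus `1`, so the fourth moment need not
be evaluated. -/
lemma abs_integral_centredProduct_mul_le (h : IsStdGaussianFamily X μ) (a b : ι × ι) :
    |∫ ω, centredProduct X a ω * centredProduct X b ω ∂μ| ≤
      (gaussianFourthMoment + 1) * ((if a = b then 1 else 0) + if a.swap = b then 1 else 0) := by
  have hκ := gaussianFourthMoment_nonneg
  rw [h.integral_centredProduct_mul]
  obtain ⟨p, q⟩ := a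
  obtain ⟨r, s⟩ := b
  have zero_of : ∫ ω, X p ω * X q ω * (X r ω * X s ω) ∂μ -
      (if p = q then 1 else 0) * (if r = s then 1 else 0) = 0 → 
      |∫ ω, X p ω * X q ω * (X r ω * X s ω) ∂μ -
      (if p = q then 1 else 0) * (if r = s then 1 else 0)| ≤ (gaussianFourthMoment + 1) *
        ((if (p, q) = (r, s) then 1 else 0) + if (p, q).swap = (r, s) then 1 else 0) := by
    intro h0
    rw [h0, abs_zero]
    positivity
  by_cases hpq : p = q
  · subst hpq
    by_cases hrs : r = s
    · subst hrs
      by_cases hpr : p = r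
      · subst hpr
        simp only [h.integral_fourth, if_true, Prod.swap]
        rw [abs_le]
        constructor <;> linarith
      · exact zero_of (by simp [h.integral_mul_mul_of_ne hpr])
    · apply zero_of
      rw [if_neg hrs, mul_zero, sub_zero]
      by_cases hpr : r = p
      · subst hpr
        rw [← h.integral_four_of_ne (Ne.symm hrs) (Ne.symm hrs) (Ne.symm hrs)]
        congr 1; ext ω; ring
      · rw [← h.integral_four_of_ne hpr hpr hrs]
        congr 1; ext ω; ring
  · have key : (p = r ∧ q = s) ∨ (p = s ∧ q = r) ∨ ∫ ω, X p ω * X q ω * (X r ω * X s ω) ∂μ = 0 := by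
      by_cases hpr : p = r
      · by_cases hqs : q = s
        · exact .inl ⟨hpr, hqs⟩
        · refine .inr (.inr ?_)
          subst hpr
          rw [← h.integral_four_of_ne (Ne.symm hpq) (Ne.symm hpq) hqs]
          congr 1; ext ω; ring
      · by_cases hps : p = s
        · by_cases hqr : q = r
          · exact .inr (.inl ⟨hps, hqr⟩)
          · refine .inr (.inr ?_)
            subst hps
            rw [← h.integral_four_of_ne (Ne.symm hpq) (Ne.symm hpq) hqr]
            congr 1; ext ω; ring
        · refine .inr (.inr ?_)
          rw [← h.integral_four_of_ne hpq hpr hps]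
          congr 1; ext ω; ring
    rcases key with ⟨rfl, rfl⟩ | ⟨rfl, rfl⟩ | h0
    · have e : ∫ ω, X p ω * X q ω * (X p ω * X q ω) ∂μ = 1 := by
        rw [← h.integral_mul_mul_of_ne hpq]
        congr 1; ext ω; ring
      simp only [e, hpq, if_true, if_false]
      rw [abs_of_nonneg (by norm_num)]
      have : (0 : ℝ) ≤ if (p, q).swap = (p, q) then 1 else 0 := by positivity
      nlinarith
    · have e : ∫ ω, X p ω * X q ω * (X q ω * X p ω) ∂μ = 1 := by
        rw [← h.integral_mul_mul_of_ne hpq]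
        congr 1; ext ω; ring
      simp only [e, hpq, if_true, if_false, Prod.swap]
      rw [abs_of_nonneg (by norm_num)]
      have : (0 : ℝ) ≤ if (p, q) = (q, p) then 1 else 0 := by positivity
      nlinarith
    · exact zero_of (by rw [h0, if_neg hpq]; simp)

end IsStdGaussianFamily

end GaussianMoments

/-! ### Mean and variance of centred quadratic forms -/

section QuadraticForm

open IsStdGaussianFamily

/-- A centred quadratic form in a family of variables, with random coefficients. -/
noncomputable def centredQuadraticForm {Ω ι : Type*} [Fintype ι] [DecidableEq ι]
    (X : ι → Ω → ℝ) (R : Ω → ι × ι → ℂ) (ω : Ω) : ℂ :=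
  ∑ a, (centredProduct X a ω : ℂ) * R ω a

lemma norm_sq_centredQuadraticForm {Ω ι : Type*} [Fintype ι] [DecidableEq ι]
    (X : ι → Ω → ℝ) (R : Ω → ι × ι → ℂ) (ω : Ω) :
    ((‖centredQuadraticForm X R ω‖ ^ 2 : ℝ) : ℂ) =
      ∑ a, ∑ b, ((centredProduct X a ω * centredProduct X b ω : ℝ) : ℂ) *
        (R ω a * starRingEnd ℂ (R ω b)) := by
  rw [← Complex.normSq_eq_norm_sq, ← Complex.mul_conj]
  unfold centredQuadraticForm
  rw [map_sum, Finset.sum_mul_sum]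
  refine Finset.sum_congr rfl fun a _ => Finset.sum_congr rfl fun b _ => ?_
  rw [map_mul, Complex.conj_ofReal]
  push_cast
  ring

variable {Ω ι : Type*} [MeasurableSpace Ω] {μ : Measure Ω} {X : ι → Ω → ℝ}
  {R : Ω → ι × ι → ℂ} {r : ℝ}

lemma integrable_ofReal_mul_of_bound {f : Ω → ℂ} {g : Ω → ℝ} {c : ℝ} (hg : Integrable g μ)
    (hf : Measurable f) (hb : ∀ ω, ‖f ω‖ ≤ c) : Integrable (fun ω => (g ω : ℂ) * f ω) μ :=
  hg.ofReal.mul_bdd (c := c) hf.aestronglyMeasurable (.of_forall hb)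

variable [DecidableEq ι] [IsProbabilityMeasure μ]

lemma integrable_norm_sq_summand (h : IsStdGaussianFamily X μ) (hR : Measurable R)
    (hb : ∀ ω a, ‖R ω a‖ ≤ r) (a b : ι × ι) :
    Integrable (fun ω => ((centredProduct X a ω * centredProduct X b ω : ℝ) : ℂ) *
        (R ω a * starRingEnd ℂ (R ω b))) μ := by
  have hRa := fun a => measurable_pi_iff.1 hR a
  refine integrable_ofReal_mul_of_bound (c := r * r) (h.integrable_centredProduct_mul a b)
    ((hRa a).mul (Complex.continuous_conj.measurable.comp (hRa b))) fun ω => ?_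
  rw [norm_mul, Complex.norm_conj]
  exact mul_le_mul (hb ω a) (hb ω b) (norm_nonneg _) ((norm_nonneg _).trans (hb ω a))

variable [Fintype ι]

lemma integrable_centredQuadraticForm (h : IsStdGaussianFamily X μ) (hR : Measurable R)
    (hb : ∀ ω a, ‖R ω a‖ ≤ r) : Integrable (centredQuadraticForm X R) μ :=
  integrable_finsetSum _ fun a _ => integrable_ofReal_mul_of_bound (h.integrable_centredProduct a)
    (measurable_pi_iff.1 hR a) fun ω => hb ω a

lemma integral_centredQuadraticForm (h : IsStdGaussianFamily X μ) (hR : Measurable R)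
    (hb : ∀ ω a, ‖R ω a‖ ≤ r) (hi : IndepFun (fun ω p => X p ω) R μ) :
    ∫ ω, centredQuadraticForm X R ω ∂μ = 0 := by
  have hm := h.measurable
  unfold centredQuadraticForm
  rw [integral_finsetSum _ fun a _ => integrable_ofReal_mul_of_bound (h.integrable_centredProduct a)
    (measurable_pi_iff.1 hR a) fun ω => hb ω a]
  refine Finset.sum_eq_zero fun a _ => ?_
  have h1 := hi.integral_fun_comp_mul_comp (𝕜 := ℂ)
    (f := fun y => ((y a.1 * y a.2 - if a.1 = a.2 then 1 else 0 : ℝ) : ℂ)) (g := fun y => y a)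
    (by fun_prop) (by fun_prop) (by fun_prop) (measurable_pi_apply a).aestronglyMeasurable
  refine h1.trans ?_
  have h2 := h.integral_centredProduct a
  unfold centredProduct at h2
  rw [integral_complex_ofReal, h2, Complex.ofReal_zero, zero_mul]

lemma integrable_norm_sq_centredQuadraticForm (h : IsStdGaussianFamily X μ) (hR : Measurable R)
    (hb : ∀ ω a, ‖R ω a‖ ≤ r) : Integrable (fun ω => ‖centredQuadraticForm X R ω‖ ^ 2) μ := by
  have h1 : Integrable (fun ω => ((‖centredQuadraticForm X R ω‖ ^ 2 : ℝ) : ℂ)) μ := by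
    simp only [norm_sq_centredQuadraticForm]
    exact integrable_finsetSum _ fun a _ => integrable_finsetSum _ fun b _ =>
      integrable_norm_sq_summand h hR hb a b
  simpa only [RCLike.re_eq_complex_re, Complex.ofReal_re] using h1.re

/-- The variance bound for a quadratic form with independent symmetric random coefficients. -/
lemma integral_norm_sq_centredQuadraticForm_le (h : IsStdGaussianFamily X μ) (hR : Measurable R)
    (hb : ∀ ω a, ‖R ω a‖ ≤ r) (hs : ∀ ω a, R ω a.swap = R ω a)
    (hi : IndepFun (fun ω p => X p ω) R μ) :
    ∫ ω, ‖centredQuadraticForm X R ω‖ ^ 2 ∂μ ≤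
      2 * (gaussianFourthMoment + 1) * ∫ ω, ∑ a, ‖R ω a‖ ^ 2 ∂μ := by
  have hm := h.measurable
  have hRa := fun a => measurable_pi_iff.1 hR a
  have hκ := gaussianFourthMoment_nonneg
  have hterm : ∀ a b, ‖∫ ω, ((centredProduct X a ω * centredProduct X b ω : ℝ) : ℂ) *
      (R ω a * starRingEnd ℂ (R ω b)) ∂μ‖ ≤ (gaussianFourthMoment + 1) *
        ((if a = b then 1 else 0) + if a.swap = b then 1 else 0) *
          ∫ ω, ‖R ω a‖ * ‖R ω b‖ ∂μ := fun a b => by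
    have h1 := hi.integral_fun_comp_mul_comp (𝕜 := ℂ)
      (f := fun y => (((y a.1 * y a.2 - if a.1 = a.2 then 1 else 0) *
        (y b.1 * y b.2 - if b.1 = b.2 then 1 else 0) : ℝ) : ℂ))
      (g := fun y => y a * starRingEnd ℂ (y b)) (by fun_prop) (by fun_prop) (by fun_prop)
      (((measurable_pi_apply a).mul (Complex.continuous_conj.measurable.comp
        (measurable_pi_apply b))).aestronglyMeasurable)
    have h2 := h.abs_integral_centredProduct_mul_le a b
    unfold centredProduct at h2 ⊢
    rw [h1, integral_complex_ofReal, norm_mul, Complex.norm_real, Real.norm_eq_abs]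
    refine mul_le_mul h2 ((norm_integral_le_integral_norm _).trans_eq ?_) (norm_nonneg _)
      ((abs_nonneg _).trans h2)
    simp only [norm_mul, Complex.norm_conj]
  have hcast : ((∫ ω, ‖centredQuadraticForm X R ω‖ ^ 2 ∂μ : ℝ) : ℂ) =
      ∑ a, ∑ b, ∫ ω, ((centredProduct X a ω * centredProduct X b ω : ℝ) : ℂ) *
        (R ω a * starRingEnd ℂ (R ω b)) ∂μ := by
    rw [← integral_complex_ofReal]
    simp only [norm_sq_centredQuadraticForm]
    rw [integral_finsetSum _ fun a _ => integrable_finsetSum _ fun b _ =>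
      integrable_norm_sq_summand h hR hb a b]
    exact Finset.sum_congr rfl fun a _ => integral_finsetSum _ fun b _ =>
      integrable_norm_sq_summand h hR hb a b
  have hnn : 0 ≤ ∫ ω, ‖centredQuadraticForm X R ω‖ ^ 2 ∂μ :=
    integral_nonneg fun ω => by positivity
  rw [← Real.norm_of_nonneg hnn, ← Complex.norm_real, hcast]
  refine (norm_sum_le _ _).trans ((Finset.sum_le_sum fun a _ => (norm_sum_le _ _).trans
    (Finset.sum_le_sum fun b _ => hterm a b)).trans (le_of_eq ?_))
  rw [integral_finsetSum, Finset.mul_sum]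
  · refine Finset.sum_congr rfl fun a _ => ?_
    -- For fixed `a` only `b = a` and `b = a.swap` survive; by symmetry of `R` both contribute `‖R
    -- a‖²`, whence the factor `2`.
    have hsw : ∀ ω, R ω (a.2, a.1) = R ω a := fun ω => hs ω a
    simp only [mul_add, add_mul, Finset.sum_add_distrib, mul_ite, mul_one, mul_zero, ite_mul,
      zero_mul, Finset.sum_ite_eq, Finset.mem_univ, if_true, Prod.swap, hsw, ← sq]
    ring
  · intro a _
    refine Integrable.of_bound ((hRa a).norm.pow_const 2).aestronglyMeasurable (r ^ 2)
      (.of_forall fun ω => ?_)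
    rw [Real.norm_of_nonneg (by positivity)]
    exact pow_le_pow_left₀ (norm_nonneg _) (hb ω a) 2

end QuadraticForm

/-! ### Deterministic first- and second-order stability bounds -/

section PathwiseBounds

variable {P N : ℕ} {d : Fin N → ℝ} {W : Matrix (Fin P) (Fin N) ℝ} {z m : ℂ}

lemma norm_div_one_add_mul_le {d : ℝ} (hd : 0 ≤ d) {s t : ℂ} (hs : 0 ≤ s.re) (ht : 0 ≤ t.re) :
    ‖(d : ℂ) / ((1 + d * s) * (1 + d * t))‖ ≤ d := by
  rw [norm_div, Complex.norm_real, Real.norm_of_nonneg hd, norm_mul]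
  refine div_le_self hd ?_
  have h1 := one_le_norm_one_add hd hs
  have h2 := one_le_norm_one_add hd ht
  nlinarith

/-- The Stieltjes transform deviates from the cone solution by at most the weighted deviation of
the leave-one-out quadratic forms. -/
lemma norm_stieltjesTransform_sub_le (hz : z.re < 0) (hN : 0 < N) (hP : 0 < P)
    (hd : ∀ i, 0 ≤ d i) (hm : IsConeSolution d ((P : ℝ) / N) z m) :
    (P : ℝ) * ‖z‖ * ‖stieltjesTransform (Matrix.diagonal d) W z - m‖ ≤
      ∑ i, d i * ‖cavityForm d W z i - stieltjesTransform (Matrix.diagonal d) W z‖ := by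
  obtain ⟨hm1, hm2⟩ := (isConeSolution_iff hN d m).1 hm
  have hs1 := stieltjesTransform_mem_spannedCone (W := W) hz hd
  have hs2 := stieltjesTransform_cavity_eq (W := W) hz hP hd
  have hg1 := fun i => re_nonneg_of_mem_spannedCone hz
    (cavityForm_mem_spannedCone (W := W) hz hd i)
  set s := stieltjesTransform (Matrix.diagonal d) W z
  have hm0 := re_nonneg_of_mem_spannedCone hz hm1
  have hs0 := re_nonneg_of_mem_spannedCone hz hs1
  have e : (z * P - ∑ i, (d i : ℂ) / ((1 + (d i : ℂ) * s) * (1 + (d i : ℂ) * m))) * (s - m) =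
      ∑ i, (cavityForm d W z i - s) *
        ((d i : ℂ) / ((1 + d i * cavityForm d W z i) * (1 + d i * s))) := by
    rw [Finset.sum_congr rfl fun i _ => (div_sub_div_one_add (hd i) (hg1 i) hs0).symm,
      Finset.sum_sub_distrib, ← hs2, sub_mul, mul_comm (∑ i, _), Finset.mul_sum,
      Finset.sum_congr rfl fun i _ => (div_sub_div_one_add (hd i) hs0 hm0).symm,
      Finset.sum_sub_distrib, ← hm2]
    ring
  calc (P : ℝ) * ‖z‖ * ‖s - m‖
      ≤ ‖z * P - ∑ i, (d i : ℂ) / ((1 + (d i : ℂ) * s) * (1 + (d i : ℂ) * m))‖ * ‖s - m‖ :=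
        mul_le_mul_of_nonneg_right (norm_divided_difference_ge hz hd P hs1 hm1) (norm_nonneg _)
    _ = _ := by rw [← norm_mul, e]
    _ ≤ _ := (norm_sum_le _ _).trans (Finset.sum_le_sum fun i _ => ?_)
  rw [norm_mul, mul_comm]
  exact mul_le_mul_of_nonneg_right (norm_div_one_add_mul_le (hd i) (hg1 i) hs0) (norm_nonneg _)

/-- Cauchy-Schwarz with weights `d i`, so that only `∑ d i` and no higher moment of the spectrum
appears. -/
lemma norm_stieltjesTransform_sub_sq_le (hz : z.re < 0) (hN : 0 < N) (hP : 0 < P)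
    (hd : ∀ i, 0 ≤ d i) (hm : IsConeSolution d ((P : ℝ) / N) z m) :
    ‖stieltjesTransform (Matrix.diagonal d) W z - m‖ ^ 2 ≤ (∑ i, d i) / ((P : ℝ) * ‖z‖) ^ 2 *
      ∑ i, d i * ‖cavityForm d W z i - stieltjesTransform (Matrix.diagonal d) W z‖ ^ 2 := by
  have h := norm_stieltjesTransform_sub_le (W := W) hz hN hP hd hm
  have hz0 := norm_pos_of_re_neg hz
  have hP' : (0 : ℝ) < P := by exact_mod_cast hP
  rw [div_mul_eq_mul_div, le_div_iff₀ (by positivity), ← mul_pow, mul_comm]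
  refine (pow_le_pow_left₀ (by positivity) h 2).trans ?_
  exact Finset.sum_sq_le_sum_mul_sum_of_sq_le_mul _ (fun i _ => hd i)
    (fun i _ => mul_nonneg (hd i) (by positivity)) fun i _ => le_of_eq (by ring)

/-- Taylor expansion at `m` with exact quadratic remainder, after splitting `g - m` as `(g - t) + (t
- s) + (s - m)`. The coefficient of `g - t` depends on `m` alone, hence is deterministic and passes
through the expectation. -/
lemma divided_difference_expansion {d g m s t : ℂ} (hg : 1 + d * g ≠ 0) (hm : 1 + d * m ≠ 0) :
    (g - m) * (d / ((1 + d * g) * (1 + d * m))) - d / ((1 + d * m) * (1 + d * m)) * (s - m) -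
        d / ((1 + d * m) * (1 + d * m)) * (g - t) =
      d / ((1 + d * m) * (1 + d * m)) * (t - s) -
        d / ((1 + d * g) * (1 + d * m)) * (d / (1 + d * m) * (g - m) ^ 2) := by
  have key : (g - m) * (d / ((1 + d * g) * (1 + d * m))) -
      d / ((1 + d * m) * (1 + d * m)) * (g - m) =
      -(d / ((1 + d * g) * (1 + d * m)) * (d / (1 + d * m) * (g - m) ^ 2)) := by
    generalize hA : 1 + d * g = A at *
    generalize hB : 1 + d * m = B at *
    have hAB : d * (g - m) = A - B := by rw [← hA, ← hB]; ring
    field_simp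
    linear_combination (d * (g - m)) * hAB
  linear_combination key

/-- Second-order expansion of the fixed-point equation around the cone solution. -/
lemma norm_linearized_le (hz : z.re < 0) (hN : 0 < N) (hP : 0 < P)
    (hd : ∀ i, 0 ≤ d i) (hm : IsConeSolution d ((P : ℝ) / N) z m) :
    ‖(z * P - ∑ i, (d i : ℂ) / ((1 + (d i : ℂ) * m) * (1 + (d i : ℂ) * m))) *
        (stieltjesTransform (Matrix.diagonal d) W z - m) -
      ∑ i, (d i : ℂ) / ((1 + (d i : ℂ) * m) * (1 + (d i : ℂ) * m)) *
        (cavityForm d W z i - cavityTrace d W z i)‖ ≤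
      ∑ i, (d i * (1 / (-z.re * P)) + d i * (‖m‖⁻¹ * ‖cavityForm d W z i - m‖ ^ 2)) := by
  obtain ⟨hm1, hm2⟩ := (isConeSolution_iff hN d m).1 hm
  have hs2 := stieltjesTransform_cavity_eq (W := W) hz hP hd
  have hg1 := fun i => re_nonneg_of_mem_spannedCone hz
    (cavityForm_mem_spannedCone (W := W) hz hd i)
  have ht := fun i => norm_cavityTrace_sub_le (W := W) hz hd i
  set s := stieltjesTransform (Matrix.diagonal d) W z
  have hm0 := re_nonneg_of_mem_spannedCone hz hm1
  have hmne := (norm_inv_isConeSolution_le hz hN hP hd hm).1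
  have e : (z * P - ∑ i, (d i : ℂ) / ((1 + (d i : ℂ) * m) * (1 + (d i : ℂ) * m))) * (s - m) -
      ∑ i, (d i : ℂ) / ((1 + (d i : ℂ) * m) * (1 + (d i : ℂ) * m)) *
        (cavityForm d W z i - cavityTrace d W z i) =
      ∑ i, ((d i : ℂ) / ((1 + (d i : ℂ) * m) * (1 + (d i : ℂ) * m)) * (cavityTrace d W z i - s) -
        (d i : ℂ) / ((1 + d i * cavityForm d W z i) * (1 + d i * m)) *
          (((d i : ℂ) / (1 + d i * m)) * (cavityForm d W z i - m) ^ 2)) := by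
    have h1 : z * P * (s - m) = ∑ i, (cavityForm d W z i - m) *
        ((d i : ℂ) / ((1 + d i * cavityForm d W z i) * (1 + d i * m))) := by
      rw [Finset.sum_congr rfl fun i _ => (div_sub_div_one_add (hd i) (hg1 i) hm0).symm,
        Finset.sum_sub_distrib, ← hs2, ← hm2]
      ring
    rw [sub_mul, h1, Finset.sum_mul, ← Finset.sum_sub_distrib, ← Finset.sum_sub_distrib]
    refine Finset.sum_congr rfl fun i _ => ?_
    exact divided_difference_expansion (one_add_ne_zero (hd i) (hg1 i)) (one_add_ne_zero (hd i) hm0)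
  rw [e]
  refine (norm_sum_le _ _).trans (Finset.sum_le_sum fun i _ => (norm_sub_le _ _).trans ?_)
  rw [norm_mul, norm_mul, norm_mul, norm_pow]
  have hx : 0 < -z.re := by linarith
  -- As `Re m ≥ 0`, `|1 + d m| ≥ |d m|`. This keeps the largest `d i` out of the constant.
  have h4 : ‖(d i : ℂ) / (1 + d i * m)‖ ≤ ‖m‖⁻¹ := by
    rw [norm_div, Complex.norm_real, Real.norm_of_nonneg (hd i), ← one_div,
      div_le_div_iff₀ (zero_lt_one.trans_le (one_le_norm_one_add (hd i) hm0))
        (norm_pos_iff.2 hmne), one_mul]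
    rw [← Real.norm_of_nonneg (hd i), ← Complex.norm_real, ← norm_mul, Complex.norm_real,
      Real.norm_of_nonneg (hd i)]
    rw [← sq_le_sq₀ (norm_nonneg _) (norm_nonneg _), ← Complex.normSq_eq_norm_sq,
      ← Complex.normSq_eq_norm_sq, Complex.normSq_add]
    have : 0 ≤ d i * m.re := mul_nonneg (hd i) hm0
    simp
    linarith
  refine add_le_add (mul_le_mul (norm_div_one_add_mul_le (hd i) hm0 hm0) (ht i) (norm_nonneg _)
    (hd i)) (mul_le_mul (norm_div_one_add_mul_le (hd i) (hg1 i) hm0) ?_ (by positivity) (hd i))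
  gcongr

end PathwiseBounds

/-! ### Independence, mean square bounds and the bias -/

section Expectation

variable {P N : ℕ} {d : Fin N → ℝ} {z m : ℂ} {Ω : Type*}

/-- The entries of the resolvent without column `i`, indexed by pairs. -/
noncomputable def cavityResolvent (d : Fin N → ℝ) (W : Matrix (Fin P) (Fin N) ℝ) (z : ℂ)
    (i : Fin N) (a : Fin P × Fin P) : ℂ :=
  wishartResolvent (Function.update d i 0) W z a.1 a.2

/-- The diagonal correction in the centred products sums to exactly the trace of the resolvent. -/
lemma cavityForm_sub_cavityTrace (W : Ω → Matrix (Fin P) (Fin N) ℝ) (i : Fin N) (ω : Ω) :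
    cavityForm d (W ω) z i - cavityTrace d (W ω) z i = 1 / (P : ℂ) *
      centredQuadraticForm (fun p ω => W ω p i) (fun ω => cavityResolvent d (W ω) z i) ω := by
  unfold cavityForm cavityTrace
  rw [stieltjesTransform_eq, ← mul_sub]
  congr 1
  unfold centredQuadraticForm centredProduct cavityResolvent
  simp only [Complex.ofReal_sub, sub_mul, Finset.sum_sub_distrib, Fintype.sum_prod_type]
  congr 1
  · simp only [dotProduct, Matrix.mulVec, complexCol, Finset.mul_sum]
    refine Finset.sum_congr rfl fun p _ => Finset.sum_congr rfl fun q _ => ?_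
    push_cast
    ring
  · refine Finset.sum_congr rfl fun p _ => ?_
    rw [Finset.sum_eq_single p]
    · simp
    · intro q _ hq
      simp [Ne.symm hq]
    · simp

/-- The matrix with entries in a given family. -/
def matrixOfFamily (X : Fin P × Fin N → Ω → ℝ) (ω : Ω) : Matrix (Fin P) (Fin N) ℝ :=
  Matrix.of fun p i => X (p, i) ω

variable [MeasurableSpace Ω] {μ : Measure Ω} {W : Ω → Matrix (Fin P) (Fin N) ℝ}

lemma continuous_cavityResolvent (hz : z.re < 0) (hd : ∀ i, 0 ≤ d i) (i : Fin N) :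
    Continuous fun W : Matrix (Fin P) (Fin N) ℝ => cavityResolvent d W z i :=
  continuous_pi fun a =>
    (continuous_wishartResolvent hz (update_zero_nonneg hd i)).matrix_elem a.1 a.2

lemma continuous_stieltjesTransform (hz : z.re < 0) (hd : ∀ i, 0 ≤ d i) :
    Continuous fun W : Matrix (Fin P) (Fin N) ℝ => stieltjesTransform (Matrix.diagonal d) W z :=
  continuous_const.mul (continuous_wishartResolvent hz hd).matrix_trace

variable {X : Fin P × Fin N → Ω → ℝ}

lemma measurable_comp_matrixOfFamily (hX : ∀ q, Measurable (X q)) {E : Type*}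
    [TopologicalSpace E] [MeasurableSpace E] [BorelSpace E]
    {f : Matrix (Fin P) (Fin N) ℝ → E} (hf : Continuous f) :
    Measurable fun ω => f (matrixOfFamily X ω) := by
  have hg : Continuous fun y : Fin P × Fin N → ℝ => f (Matrix.of fun p i => y (p, i)) :=
    hf.comp (continuous_pi fun p => continuous_pi fun i => continuous_apply (p, i))
  exact hg.measurable.comp (measurable_pi_iff.2 hX)

lemma IsStdGaussianFamily.col (h : IsStdGaussianFamily X μ) (i : Fin N) :
    IsStdGaussianFamily (fun p ω => matrixOfFamily X ω p i) μ where
  measurable p := h.measurable (p, i)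
  hasLaw p := h.hasLaw (p, i)
  iIndepFun := h.iIndepFun.precomp (g := fun p => (p, i)) fun _ _ hpq => (Prod.ext_iff.1 hpq).1

lemma indepFun_col_cavityResolvent (hz : z.re < 0) (hd : ∀ i, 0 ≤ d i)
    (h : IsStdGaussianFamily X μ) (i : Fin N) :
    IndepFun (fun ω p => matrixOfFamily X ω p i)
      (fun ω => cavityResolvent d (matrixOfFamily X ω) z i) μ := by
  classical
  let S : Finset (Fin P × Fin N) := Finset.univ.filter fun q => q.2 = i
  let T : Finset (Fin P × Fin N) := Finset.univ.filter fun q => ¬ q.2 = i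
  have hST : Disjoint S T := Finset.disjoint_filter_filter_not _ _ _
  -- The resolvent factors through the entries outside column `i`; that column has weight zero, so
  -- it may be filled with `0`.
  have hψ : Continuous fun y : T → ℝ => cavityResolvent d
      (Matrix.of fun p j => if hj : j = i then 0 else y ⟨(p, j), by simp [T, hj]⟩) z i := by
    refine (continuous_cavityResolvent hz hd i).comp
      (continuous_pi fun p => continuous_pi fun j => ?_)
    simp only [Matrix.of_apply]
    split_ifs
    · exact continuous_const
    · exact continuous_apply _
  have key := (h.iIndepFun.indepFun_finset S T hST h.measurable).comp
    (φ := fun (y : S → ℝ) (p : Fin P) => y ⟨(p, i), by simp [S]⟩)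
    (measurable_pi_iff.2 fun p => measurable_pi_apply _) hψ.measurable
  have e : (fun ω => cavityResolvent d (matrixOfFamily X ω) z i) =
      (fun y : T → ℝ => cavityResolvent d
        (Matrix.of fun p j => if hj : j = i then 0 else y ⟨(p, j), by simp [T, hj]⟩) z i) ∘
        fun ω (q : T) => X q ω := by
    funext ω a
    simp only [Function.comp, cavityResolvent]
    rw [wishartResolvent_update_congr]
    intro p j hj
    simp [matrixOfFamily, hj]
  rw [e]
  exact key

lemma norm_cavityResolvent_le (hz : z.re < 0) (hd : ∀ i, 0 ≤ d i) (i : Fin N)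
    (W : Matrix (Fin P) (Fin N) ℝ) (a : Fin P × Fin P) :
    ‖cavityResolvent d W z i a‖ ≤ 1 / -z.re :=
  norm_wishartResolvent_apply_le hz (update_zero_nonneg hd i) _ _

lemma measurable_cavityResolvent (hz : z.re < 0) (hd : ∀ i, 0 ≤ d i)
    (h : IsStdGaussianFamily X μ) (i : Fin N) :
    Measurable fun ω => cavityResolvent d (matrixOfFamily X ω) z i :=
  measurable_comp_matrixOfFamily h.measurable (continuous_cavityResolvent hz hd i)

section

variable [IsProbabilityMeasure μ]

lemma integrable_stieltjesTransform (hz : z.re < 0) (hd : ∀ i, 0 ≤ d i)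
    (h : IsStdGaussianFamily X μ) :
    Integrable (fun ω => stieltjesTransform (Matrix.diagonal d) (matrixOfFamily X ω) z) μ :=
  Integrable.of_bound (measurable_comp_matrixOfFamily h.measurable
    (continuous_stieltjesTransform hz hd)).aestronglyMeasurable (1 / -z.re)
    (.of_forall fun _ => norm_stieltjesTransform_le hz hd)

lemma integrable_cavityForm_sub_cavityTrace (hz : z.re < 0) (hd : ∀ i, 0 ≤ d i)
    (h : IsStdGaussianFamily X μ) (i : Fin N) :
    Integrable (fun ω => cavityForm d (matrixOfFamily X ω) z i -
      cavityTrace d (matrixOfFamily X ω) z i) μ := by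
  simp only [cavityForm_sub_cavityTrace]
  exact (integrable_centredQuadraticForm (h.col i) (measurable_cavityResolvent hz hd h i)
    fun ω a => norm_cavityResolvent_le hz hd i _ a).const_mul _

lemma integral_cavityForm_sub_cavityTrace (hz : z.re < 0) (hd : ∀ i, 0 ≤ d i)
    (h : IsStdGaussianFamily X μ) (i : Fin N) :
    ∫ ω, (cavityForm d (matrixOfFamily X ω) z i -
      cavityTrace d (matrixOfFamily X ω) z i) ∂μ = 0 := by
  simp only [cavityForm_sub_cavityTrace]
  rw [integral_const_mul, integral_centredQuadraticForm (h.col i)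
    (measurable_cavityResolvent hz hd h i) (fun ω a => norm_cavityResolvent_le hz hd i _ a)
    (indepFun_col_cavityResolvent hz hd h i), mul_zero]

lemma integrable_norm_sq_cavityForm_sub_cavityTrace (hz : z.re < 0) (hd : ∀ i, 0 ≤ d i)
    (h : IsStdGaussianFamily X μ) (i : Fin N) :
    Integrable (fun ω => ‖cavityForm d (matrixOfFamily X ω) z i -
      cavityTrace d (matrixOfFamily X ω) z i‖ ^ 2) μ := by
  simp only [cavityForm_sub_cavityTrace, norm_mul, mul_pow]
  exact (integrable_norm_sq_centredQuadraticForm (h.col i) (measurable_cavityResolvent hz hd h i)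
    fun ω a => norm_cavityResolvent_le hz hd i _ a).const_mul _

/-- The constant in the variance bound for the leave-one-out quadratic forms. -/
noncomputable def cavityConst (z : ℂ) : ℝ := 2 * (gaussianFourthMoment + 1) / z.re ^ 2

lemma cavityConst_nonneg (z : ℂ) : 0 ≤ cavityConst z := by
  have := gaussianFourthMoment_nonneg
  unfold cavityConst
  positivity

lemma integral_norm_sq_cavityForm_sub_cavityTrace_le (hz : z.re < 0) (hP : 0 < P)
    (hd : ∀ i, 0 ≤ d i) (h : IsStdGaussianFamily X μ) (i : Fin N) :
    ∫ ω, ‖cavityForm d (matrixOfFamily X ω) z i -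
      cavityTrace d (matrixOfFamily X ω) z i‖ ^ 2 ∂μ ≤ cavityConst z / P := by
  have hκ := gaussianFourthMoment_nonneg
  have hP' : (0 : ℝ) < P := by exact_mod_cast hP
  have hsum : ∀ ω, ∑ a, ‖cavityResolvent d (matrixOfFamily X ω) z i a‖ ^ 2 ≤ P / z.re ^ 2 :=
    fun ω => by
      rw [Fintype.sum_prod_type]
      exact sum_norm_sq_wishartResolvent_le hz (update_zero_nonneg hd i)
  have h1 : ∫ ω, ∑ a, ‖cavityResolvent d (matrixOfFamily X ω) z i a‖ ^ 2 ∂μ ≤ P / z.re ^ 2 := by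
    refine (integral_mono_of_nonneg (.of_forall fun ω => ?_) (integrable_const _)
      (.of_forall hsum)).trans (by simp)
    exact Finset.sum_nonneg fun a _ => by positivity
  have h2 := integral_norm_sq_centredQuadraticForm_le (h.col i)
    (measurable_cavityResolvent hz hd h i) (fun ω a => norm_cavityResolvent_le hz hd i _ a)
    (fun ω a => wishartResolvent_isSymm.apply a.1 a.2) (indepFun_col_cavityResolvent hz hd h i)
  simp only [cavityForm_sub_cavityTrace, norm_mul, mul_pow]
  rw [integral_const_mul, norm_div, norm_one, Complex.norm_natCast]
  calc (1 / (P : ℝ)) ^ 2 * ∫ ω, ‖centredQuadraticForm (fun p ω => matrixOfFamily X ω p i)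
        (fun ω => cavityResolvent d (matrixOfFamily X ω) z i) ω‖ ^ 2 ∂μ
      ≤ (1 / (P : ℝ)) ^ 2 * (2 * (gaussianFourthMoment + 1) * (P / z.re ^ 2)) := by
        gcongr
        exact h2.trans (by gcongr)
    _ = cavityConst z / P := by
        unfold cavityConst
        have := hz.ne
        field_simp

lemma norm_sub_sq_le_two_mul (a b c : ℂ) :
    ‖a - c‖ ^ 2 ≤ 2 * ‖a - b‖ ^ 2 + 2 * ‖b - c‖ ^ 2 := by
  have h1 := norm_sub_le_norm_sub_add_norm_sub a b c
  nlinarith [norm_nonneg (a - c), sq_nonneg (‖a - b‖ - ‖b - c‖)]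

/-- The trace shift contributes `1/P²`, relaxed to `1/P` to match the order of the variance. -/
lemma norm_sq_cavityForm_sub_le (hz : z.re < 0) (hP : 0 < P) (hd : ∀ i, 0 ≤ d i)
    (W : Matrix (Fin P) (Fin N) ℝ) (i : Fin N) :
    ‖cavityForm d W z i - stieltjesTransform (Matrix.diagonal d) W z‖ ^ 2 ≤
      2 * ‖cavityForm d W z i - cavityTrace d W z i‖ ^ 2 + 2 / z.re ^ 2 / P := by
  have hP' : (1 : ℝ) ≤ P := by exact_mod_cast hP
  have hx : 0 < -z.re := by linarith
  refine (norm_sub_sq_le_two_mul _ (cavityTrace d W z i) _).trans ?_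
  gcongr
  refine (mul_le_mul_of_nonneg_left (pow_le_pow_left₀ (norm_nonneg _)
    (norm_cavityTrace_sub_le hz hd i) 2) zero_le_two).trans ?_
  rw [div_pow, one_pow, mul_one_div, div_div, mul_pow, neg_sq]
  have : 0 < z.re ^ 2 := by nlinarith
  gcongr
  nlinarith

/-- The constant in the mean square bounds. -/
noncomputable def meanSquareConst (z : ℂ) : ℝ := 2 * cavityConst z + 2 / z.re ^ 2

lemma meanSquareConst_nonneg (z : ℂ) : 0 ≤ meanSquareConst z := by
  have := cavityConst_nonneg z
  unfold meanSquareConst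
  positivity

/-- A pathwise bound for the mean square deviation from the cone solution. -/
noncomputable def pathwiseBound (d : Fin N → ℝ) (W : Matrix (Fin P) (Fin N) ℝ) (z : ℂ)
    (i : Fin N) : ℝ :=
  2 * ‖cavityForm d W z i - cavityTrace d W z i‖ ^ 2 + 2 / z.re ^ 2 / P

lemma integrable_pathwiseBound (hz : z.re < 0) (hd : ∀ i, 0 ≤ d i)
    (h : IsStdGaussianFamily X μ) (i : Fin N) :
    Integrable (fun ω => pathwiseBound d (matrixOfFamily X ω) z i) μ :=
  ((integrable_norm_sq_cavityForm_sub_cavityTrace hz hd h i).const_mul _).add (integrable_const _)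

lemma integral_pathwiseBound_le (hz : z.re < 0) (hP : 0 < P) (hd : ∀ i, 0 ≤ d i)
    (h : IsStdGaussianFamily X μ) (i : Fin N) :
    ∫ ω, pathwiseBound d (matrixOfFamily X ω) z i ∂μ ≤ meanSquareConst z / P := by
  unfold pathwiseBound
  rw [integral_add ((integrable_norm_sq_cavityForm_sub_cavityTrace hz hd h i).const_mul _)
    (integrable_const _), integral_const_mul]
  have := integral_norm_sq_cavityForm_sub_cavityTrace_le hz hP hd h i
  simp only [integral_const, probReal_univ, one_smul]
  unfold meanSquareConst
  rw [add_div, mul_div_assoc]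
  gcongr

lemma norm_sq_cavityForm_sub_coneSolution_le (hz : z.re < 0) (hN : 0 < N) (hP : 0 < P)
    (hd : ∀ i, 0 ≤ d i) (hm : IsConeSolution d ((P : ℝ) / N) z m)
    (W : Matrix (Fin P) (Fin N) ℝ) (i : Fin N) :
    ‖cavityForm d W z i - m‖ ^ 2 ≤ 2 * pathwiseBound d W z i +
      2 * ((∑ i, d i) / ((P : ℝ) * ‖z‖) ^ 2 * ∑ j, d j * pathwiseBound d W z j) := by
  have hS : 0 ≤ ∑ i, d i := Finset.sum_nonneg fun i _ => hd i
  refine (norm_sub_sq_le_two_mul _ (stieltjesTransform (Matrix.diagonal d) W z) _).trans ?_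
  gcongr
  · exact norm_sq_cavityForm_sub_le hz hP hd W i
  · refine (norm_stieltjesTransform_sub_sq_le hz hN hP hd hm).trans ?_
    gcongr with j
    · exact hd j
    · exact norm_sq_cavityForm_sub_le hz hP hd W j

/-- The constant in the bound on the bias, as a function of `z` and `s = (1/P) ∑ d i`. -/
noncomputable def biasConst (z : ℂ) (s : ℝ) : ℝ :=
  s * (1 / -z.re + (‖z‖ + s) * (2 * meanSquareConst z * (1 + (s / ‖z‖) ^ 2))) / ‖z‖

lemma norm_integral_stieltjesTransform_sub_le (hz : z.re < 0) (hN : 0 < N) (hP : 0 < P)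
    (hd : ∀ i, 0 ≤ d i) (h : IsStdGaussianFamily X μ)
    (hm : IsConeSolution d ((P : ℝ) / N) z m) :
    ‖∫ ω, stieltjesTransform (Matrix.diagonal d) (matrixOfFamily X ω) z ∂μ - m‖ ≤
      biasConst z ((∑ i, d i) / P) / P := by
  have hP' : (0 : ℝ) < P := by exact_mod_cast hP
  have hz0 := norm_pos_of_re_neg hz
  have hS : 0 ≤ ∑ i, d i := Finset.sum_nonneg fun i _ => hd i
  have hC := meanSquareConst_nonneg z
  obtain ⟨hm1, -⟩ := (isConeSolution_iff hN d m).1 hm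
  have hD := norm_divided_difference_ge hz hd P hm1 hm1
  have hinv := (norm_inv_isConeSolution_le hz hN hP hd hm).2
  set S := ∑ i, d i
  set D := z * P - ∑ i, (d i : ℂ) / ((1 + (d i : ℂ) * m) * (1 + (d i : ℂ) * m))
  set w : Fin N → ℂ := fun i => (d i : ℂ) / ((1 + (d i : ℂ) * m) * (1 + (d i : ℂ) * m))
  have hint := integrable_stieltjesTransform hz hd h
  have hsub : Integrable (fun ω => D *
      (stieltjesTransform (Matrix.diagonal d) (matrixOfFamily X ω) z - m)) μ :=
    (hint.sub (integrable_const m)).const_mul D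
  have hcav : Integrable (fun ω => ∑ i, w i * (cavityForm d (matrixOfFamily X ω) z i -
      cavityTrace d (matrixOfFamily X ω) z i)) μ :=
    integrable_finsetSum _ fun i _ =>
      (integrable_cavityForm_sub_cavityTrace hz hd h i).const_mul _
  have hpath := integrable_pathwiseBound (X := X) (μ := μ) hz hd h
  -- The fluctuation term may be subtracted freely because its mean is zero; without it the
  -- integrand would be too large for the rate `1/P`.
  have h1 : D * (∫ ω, stieltjesTransform (Matrix.diagonal d) (matrixOfFamily X ω) z ∂μ - m) =
      ∫ ω, (D * (stieltjesTransform (Matrix.diagonal d) (matrixOfFamily X ω) z - m) -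
        ∑ i, w i * (cavityForm d (matrixOfFamily X ω) z i -
          cavityTrace d (matrixOfFamily X ω) z i)) ∂μ := by
    rw [integral_sub hsub hcav, integral_const_mul, integral_sub hint (integrable_const m),
      integral_finsetSum _ fun i _ =>
        (integrable_cavityForm_sub_cavityTrace hz hd h i).const_mul _]
    simp [integral_const_mul, integral_cavityForm_sub_cavityTrace hz hd h]
  let b : Fin N → Ω → ℝ := fun i ω => 2 * pathwiseBound d (matrixOfFamily X ω) z i +
    2 * (S / ((P : ℝ) * ‖z‖) ^ 2 * ∑ j, d j * pathwiseBound d (matrixOfFamily X ω) z j)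
  have hb1 : ∀ i, Integrable (b i) μ := fun i =>
    ((hpath i).const_mul _).add (((integrable_finsetSum _ fun j _ =>
      (hpath j).const_mul _).const_mul _).const_mul _)
  have hb2 : ∀ i, ∫ ω, b i ω ∂μ ≤ 2 * meanSquareConst z * (1 + (S / P / ‖z‖) ^ 2) / P :=
    fun i => by
      have hp := integral_pathwiseBound_le (X := X) (μ := μ) hz hP hd h
      simp only [b]
      rw [integral_add ((hpath i).const_mul _) (((integrable_finsetSum _ fun j _ =>
        (hpath j).const_mul _).const_mul _).const_mul _), integral_const_mul, integral_const_mul,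
        integral_const_mul, integral_finsetSum _ fun j _ => (hpath j).const_mul _]
      simp only [integral_const_mul]
      calc _ ≤ 2 * (meanSquareConst z / P) + 2 * (S / ((P : ℝ) * ‖z‖) ^ 2 *
            ∑ j, d j * (meanSquareConst z / P)) := by
            gcongr with j
            · exact hp i
            · exact hd j
            · exact hp j
        _ = _ := by
            rw [← Finset.sum_mul]
            change _ + 2 * (_ * (S * _)) = _
            field_simp
  have h2 : ‖D‖ * ‖∫ ω, stieltjesTransform (Matrix.diagonal d) (matrixOfFamily X ω) z ∂μ - m‖ ≤
      S * (1 / (-z.re * P) + (‖z‖ + S / P) *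
        (2 * meanSquareConst z * (1 + (S / P / ‖z‖) ^ 2) / P)) := by
    rw [← norm_mul, h1]
    refine (norm_integral_le_integral_norm _).trans ?_
    have hbi : Integrable (fun ω => ∑ i, (d i * (1 / (-z.re * P)) +
        d i * (‖m‖⁻¹ * b i ω))) μ :=
      integrable_finsetSum _ fun i _ =>
        (integrable_const _).add (((hb1 i).const_mul _).const_mul _)
    refine (integral_mono_of_nonneg (.of_forall fun ω => norm_nonneg _) hbi
      (.of_forall fun ω => (norm_linearized_le hz hN hP hd hm).trans ?_)).trans ?_
    · simp only [b]
      gcongr with i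
      · exact hd i
      · exact norm_sq_cavityForm_sub_coneSolution_le hz hN hP hd hm _ i
    · have hbi' : ∀ i, Integrable (fun ω => d i * (1 / (-z.re * P)) +
          d i * (‖m‖⁻¹ * b i ω)) μ := fun i =>
        (integrable_const _).add (((hb1 i).const_mul _).const_mul _)
      rw [integral_finsetSum _ fun i _ => hbi' i, Finset.sum_mul]
      refine Finset.sum_le_sum fun i _ => ?_
      rw [integral_add (integrable_const _) (((hb1 i).const_mul _).const_mul _),
        integral_const_mul, integral_const_mul]
      simp only [integral_const, probReal_univ, one_smul]
      rw [← mul_add]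
      gcongr
      · exact hd i
      · rw [integral_const_mul]
        exact mul_le_mul hinv (hb2 i)
          (integral_nonneg fun ω => (sq_nonneg _).trans
            (norm_sq_cavityForm_sub_coneSolution_le hz hN hP hd hm _ i)) (by positivity)
  -- The right side of `h2` is bounded in terms of `z` and `S / P`; dividing by `P ‖z‖ ≤ ‖D‖`
  -- produces the factor `1/P`.
  have h3 := (mul_le_mul_of_nonneg_right hD (norm_nonneg
    (∫ ω, stieltjesTransform (Matrix.diagonal d) (matrixOfFamily X ω) z ∂μ - m))).trans h2
  rw [mul_comm, ← le_div_iff₀ (by positivity)] at h3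
  refine h3.trans_eq ?_
  unfold biasConst
  have := hz.ne
  field_simp

end

/-- Standard Gaussian entries agree almost surely with a measurable family. -/
lemma exists_isStdGaussianFamily (h : IsStdGaussianMatrix W μ) :
    ∃ X : Fin P × Fin N → Ω → ℝ, IsStdGaussianFamily X μ ∧ W =ᵐ[μ] matrixOfFamily X := by
  have hae : ∀ q : Fin P × Fin N, AEMeasurable (fun ω => W ω q.1 q.2) μ :=
    fun q => (h.1 q.1 q.2).aemeasurable
  refine ⟨fun q => (hae q).mk, ⟨fun q => (hae q).measurable_mk,
    fun q => (h.1 q.1 q.2).congr (hae q).ae_eq_mk.symm,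
    h.2.congr fun q => (hae q).ae_eq_mk⟩, ?_⟩
  filter_upwards [ae_all_iff.2 fun q => (hae q).ae_eq_mk] with ω hω
  ext p i
  exact hω (p, i)

end Expectation

theorem mainTheorem11 :
    ∃ e : ℂ → ℝ → ℝ → ℝ,
      ∀ z : ℂ, z.re < 0 →
      ∀ N P : ℕ, 0 < N → 0 < P →
      ∀ d : Fin N → ℝ, (∀ i, 0 ≤ d i) →
        (∃! m : ℂ, IsConeSolution d ((P : ℝ) / (N : ℝ)) z m) ∧
        ∀ (Ω : Type*) [MeasurableSpace Ω] (μ : Measure Ω) [IsProbabilityMeasure μ]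
          (W : Ω → Matrix (Fin P) (Fin N) ℝ), IsStdGaussianMatrix W μ →
          Integrable (fun ω => stieltjesTransform (Matrix.diagonal d) (W ω) z) μ ∧
          ∀ m : ℂ, IsConeSolution d ((P : ℝ) / (N : ℝ)) z m →
            ‖(∫ ω, stieltjesTransform (Matrix.diagonal d) (W ω) z ∂μ) - m‖ ≤
              e z ((P : ℝ) / (N : ℝ)) (1 / (N : ℝ) * (Matrix.diagonal d).trace) / (P : ℝ) := by
  -- With `t` the normalized trace and `γ = P/N`, the ratio `t / γ` equals `(∑ d i) / P`.
  refine ⟨fun z γ t => biasConst z (t / γ), fun z hz N P hN hP d hd => ⟨?_, ?_⟩⟩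
  · obtain ⟨m, hm⟩ := exists_isConeSolution hz hN hP hd
    exact ⟨m, hm, fun m' hm' => isConeSolution_unique hz hN hP hd hm' hm⟩
  · intro Ω _ μ _ W hW
    obtain ⟨X, hX, hWX⟩ := exists_isStdGaussianFamily hW
    have hae : (fun ω => stieltjesTransform (Matrix.diagonal d) (W ω) z) =ᵐ[μ]
        fun ω => stieltjesTransform (Matrix.diagonal d) (matrixOfFamily X ω) z := by
      filter_upwards [hWX] with ω hω
      rw [hω]
    refine ⟨(integrable_stieltjesTransform hz hd hX).congr hae.symm, fun m hm => ?_⟩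
    rw [integral_congr_ae hae]
    refine (norm_integral_stieltjesTransform_sub_le hz hN hP hd hX hm).trans_eq ?_
    have hN' : (N : ℝ) ≠ 0 := by exact_mod_cast hN.ne'
    have hP' : (P : ℝ) ≠ 0 := by exact_mod_cast hP.ne'
    rw [Matrix.trace_diagonal]
    congr 2
    field_simp
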